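/- Let $G$ be a finite 3-group with $|G:G'| = 9$ and $|G| \ge 81$. Write $\gamma_1(G)=G$, $\gamma_{i+1}(G)=[\gamma_i(G),G]$ for the terms of the lower central series, and let $G^3$ be the subgroup generated by all cubes $g^3$, $g\in G$. Then: (1) $G^3 = \gamma_3(G)$, and this subgroup has index $27$ in $G$. (2) Every maximal subgroup of $G$ can be generated by at most $3$ elements. (3) Some maximal subgroup of $G$ is metacyclic (that is, has a cyclic normal subgroup with cyclic quotient), or some maximal subgroup $H$ of $G$ satisfies $|H:H'| \le 27$ (possibly both). (4) If $|G:\gamma_4(G)| = 3^4$, then $G$ is of maximal class, that is, $|G| = 3^n$ with $n \ge 3$ and $G$ is nilpotent of class $n-1$. -/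

import Mathlib

/-- `γ_n(G)`, the `n`-th term of the lower central series in the usual numbering from `1`:
`γ_1(G) = G`, `γ_{n+1}(G) = [γ_n(G), G]` (with `γ_0(G) = G` as a dummy value). -/
def gammaSubgroup (G : Type*) [Group G] (n : ℕ) : Subgroup G :=
  (⊤ : Subgroup G).lowerCentralSeries (n - 1)

/-- `G^n`, the subgroup generated by all `n`-th powers of elements of `G`. -/
def powerSubgroup (G : Type*) [Group G] (n : ℕ) : Subgroup G :=
  Subgroup.closure (Set.range fun g : G => g ^ n)

/-- A group is metacyclic if it has a cyclic normal subgroup with cyclic quotient. -/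
def IsMetacyclic (G : Type*) [Group G] : Prop :=
  ∃ (N : Subgroup G) (_ : N.Normal), IsCyclic N ∧ IsCyclic (G ⧸ N)

/-- A group of order `p ^ n` with `n ≥ 3` is of maximal class if it is nilpotent of
class `n - 1`. -/
def IsOfMaximalClass (p : ℕ) (G : Type*) [Group G] : Prop :=
  ∃ n : ℕ, 3 ≤ n ∧ Nat.card G = p ^ n ∧ Group.IsNilpotent G ∧ Group.nilpotencyClass G = n - 1

open Subgroup
open scoped commutatorElement

/-! ### Lower central series calculus modulo a normal subgroup. -/

section Basics

variable {G : Type*} [Group G]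

/-! Write γ_i for the lower central terms. As `G` is nilpotent and not cyclic, `G/G'` has exponent
3, hence so does every factor γ_i/γ_{i+1}. Moreover `G = ⟨x, y⟩`, so γ_2/γ_3 is generated by `[y,
x]` and has order 3. Everything else is commutator calculation modulo small normal subgroups,
together with a Nakayama principle: γ_n ≤ Mγ_{n+1} forces γ_n ≤ M
(`gammaSubgroup_le_of_le_sup_succ`).

(1) A group of exponent 3 is 2-Engel, so `G/G^3` has class at most 2 and γ_3 ≤ `G^3`. Conversely, if
some `g^3` lay outside γ_3 it would generate γ_2 modulo γ_3 while commuting with a generating pair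
modulo γ_4, forcing γ_3 = γ_4 (`pow_three_mem_gammaSubgroup_three`).

(2) A maximal subgroup is `H = ⟨h⟩G'`. Modulo `H'` it is generated by the conjugates of `h` under 1,
`g`, `g^2`, because `g^3 ∈ H`.

(3) The second alternative always holds. If γ_4 ≤ `H'` then `|H:H'| ≤ 27`. If not, the action of `g`
on `H/H'γ_5` yields `h^3 ≡ [g,[g,h]]⁻¹` modulo `H'γ_4`. Imposing this on all four maximal subgroups,
with `h = x, y, yx, y⁻¹x`, gives linear equations in `G/γ_4` that are inconsistent with γ_4 ≰ `H'`
for the last two (`exists_zpow_eq_of_class_three`).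

(4) When γ_3/γ_4 has order 3, some generator `s₁` centralizes γ_2 modulo γ_4. If `s^3 ∉ γ_4` for the
complementary generator `s`, then γ_4 = 1. Otherwise the triviality of `s^3` in low weight relates
cubes to triple commutators, and an induction shows that `s₁` centralizes every γ_n modulo γ_{n+2},
so each factor is generated by a single commutator with `s` (`relIndex_gammaSubgroup_dvd_three`). -/

theorem gammaSubgroup_one : gammaSubgroup G 1 = ⊤ := rfl

theorem gammaSubgroup_two : gammaSubgroup G 2 = commutator G := rfl

theorem gammaSubgroup_add_two (n : ℕ) :
    gammaSubgroup G (n + 2) = ⁅gammaSubgroup G (n + 1), (⊤ : Subgroup G)⁆ := rfl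

instance gammaSubgroup_normal (n : ℕ) : (gammaSubgroup G n).Normal :=
  Subgroup.lowerCentralSeries_normal _ _

theorem gammaSubgroup_antitone : Antitone (gammaSubgroup G) := fun _ _ h =>
  Subgroup.lowerCentralSeries_antitone (S := (⊤ : Subgroup G)) (Nat.sub_le_sub_right h 1)

/-- The three subgroups lemma modulo a normal subgroup. -/
theorem commutator_commutator_le_of_rotate {H₁ H₂ H₃ N : Subgroup G} [N.Normal]
    (h1 : ⁅⁅H₂, H₃⁆, H₁⁆ ≤ N) (h2 : ⁅⁅H₃, H₁⁆, H₂⁆ ≤ N) : ⁅⁅H₁, H₂⁆, H₃⁆ ≤ N := by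
  have key : ∀ K : Subgroup G, K ≤ N ↔ K.map (QuotientGroup.mk' N) = ⊥ := fun K => by
    rw [Subgroup.map_eq_bot_iff, QuotientGroup.ker_mk']
  rw [key, Subgroup.map_commutator, Subgroup.map_commutator] at *
  exact Subgroup.commutator_commutator_eq_bot_of_rotate h1 h2

theorem commutator_gammaSubgroup_le (i j : ℕ) :
    ⁅gammaSubgroup G (i + 1), gammaSubgroup G (j + 1)⁆ ≤ gammaSubgroup G (i + j + 2) := by
  induction j generalizing i with
  | zero => exact le_rfl
  | succ j ih =>
    rw [gammaSubgroup_add_two, Subgroup.commutator_comm]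
    refine commutator_commutator_le_of_rotate ?_ ?_
    · rw [Subgroup.commutator_comm ⊤]
      refine (ih (i + 1)).trans (le_of_eq ?_)
      congr 1; omega
    · exact Subgroup.commutator_mono (ih i) le_rfl

theorem commutatorElement_mem_gammaSubgroup {i j k : ℕ} {a b : G} (hi : 1 ≤ i) (hj : 1 ≤ j)
    (ha : a ∈ gammaSubgroup G i) (hb : b ∈ gammaSubgroup G j) (hk : k ≤ i + j) :
    ⁅a, b⁆ ∈ gammaSubgroup G k := by
  obtain ⟨i, rfl⟩ := Nat.exists_eq_add_of_le' hi
  obtain ⟨j, rfl⟩ := Nat.exists_eq_add_of_le' hj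
  exact gammaSubgroup_antitone (by omega : k ≤ i + j + 2)
    (commutator_gammaSubgroup_le i j (commutator_mem_commutator ha hb))

theorem commutatorElement_mem_gammaSubgroup_succ {n : ℕ} {b : G} (hn : 1 ≤ n) (a : G)
    (hb : b ∈ gammaSubgroup G n) : ⁅a, b⁆ ∈ gammaSubgroup G (n + 1) :=
  commutatorElement_mem_gammaSubgroup le_rfl hn (Subgroup.mem_top a) hb (by omega)

theorem commutatorElement_mem_comm {N : Subgroup G} {a b : G} : ⁅a, b⁆ ∈ N ↔ ⁅b, a⁆ ∈ N := by
  rw [← commutatorElement_inv, inv_mem_iff]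

theorem commute_mk_iff {N : Subgroup G} [N.Normal] {a b : G} :
    Commute (a : G ⧸ N) (b : G ⧸ N) ↔ ⁅a, b⁆ ∈ N := by
  rw [← commutatorElement_eq_one_iff_commute, ← QuotientGroup.eq_one_iff]
  rfl

/-- `N.upperCentralSeriesStep` is the preimage of the centre of `G ⧸ N`; it serves throughout to
express "central modulo `N`". -/
theorem mem_upperCentralSeriesStep_iff {N : Subgroup G} [N.Normal] {z : G} :
    z ∈ N.upperCentralSeriesStep ↔ ∀ g : G, ⁅g, z⁆ ∈ N := by
  rw [Subgroup.mem_upperCentralSeriesStep]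
  refine forall_congr' fun g => ?_
  rw [← commutatorElement_inv, inv_mem_iff]

theorem mem_upperCentralSeriesStep_of_closure_eq_top {N : Subgroup G} [N.Normal] {S : Set G}
    (hS : closure S = ⊤) {z : G} (hz : ∀ s ∈ S, ⁅s, z⁆ ∈ N) : z ∈ N.upperCentralSeriesStep := by
  rw [mem_upperCentralSeriesStep_iff]
  intro g
  have hle : closure S ≤ (centralizer {(z : G ⧸ N)}).comap (QuotientGroup.mk' N) := by
    rw [closure_le]
    intro s hs
    simp only [coe_comap, Set.mem_preimage, SetLike.mem_coe, mem_centralizer_singleton_iff]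
    exact commute_mk_iff.mpr (hz s hs)
  have hg : g ∈ closure S := hS ▸ mem_top g
  have := hle hg
  simp only [mem_comap, mem_centralizer_singleton_iff] at this
  exact commute_mk_iff.mp this

theorem gammaSubgroup_succ_le_of_le_upperCentralSeriesStep {N : Subgroup G} [N.Normal] {n : ℕ}
    (hn : 1 ≤ n) (h : gammaSubgroup G n ≤ N.upperCentralSeriesStep) :
    gammaSubgroup G (n + 1) ≤ N := by
  obtain ⟨n, rfl⟩ := Nat.exists_eq_add_of_le' hn
  rw [gammaSubgroup_add_two, Subgroup.commutator_comm, Subgroup.commutator_le]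
  exact fun g _ z hz => mem_upperCentralSeriesStep_iff.mp (h hz) g

theorem le_upperCentralSeriesStep_of_le {M N : Subgroup G} [N.Normal] (h : M ≤ N) :
    M ≤ N.upperCentralSeriesStep := fun z hz =>
  mem_upperCentralSeriesStep_iff.mpr fun g => by
    rw [commutatorElement_def]
    exact N.mul_mem (‹N.Normal›.conj_mem z (h hz) g) (N.inv_mem (h hz))

theorem gammaSubgroup_le_upperCentralSeriesStep {N : Subgroup G} [N.Normal] {n : ℕ} (hn : 1 ≤ n)
    (h : gammaSubgroup G (n + 1) ≤ N) : gammaSubgroup G n ≤ N.upperCentralSeriesStep := fun _ hz =>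
  mem_upperCentralSeriesStep_iff.mpr fun g => h (commutatorElement_mem_gammaSubgroup_succ hn g hz)

/-- A subgroup between `N` and the preimage of the centre of `G ⧸ N` is normal. -/
theorem normal_of_le_upperCentralSeriesStep {M N : Subgroup G} [N.Normal] (h : N ≤ M)
    (h' : M ≤ N.upperCentralSeriesStep) : M.Normal := by
  refine ⟨fun z hz g => ?_⟩
  have : g * z * g⁻¹ = ⁅g, z⁆ * z := by simp [commutatorElement_def]
  rw [this]
  exact M.mul_mem (h (mem_upperCentralSeriesStep_iff.mp (h' hz) g)) hz

theorem zpowers_sup_normal {N : Subgroup G} [N.Normal] {z : G}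
    (hz : z ∈ N.upperCentralSeriesStep) : (zpowers z ⊔ N).Normal :=
  normal_of_le_upperCentralSeriesStep le_sup_right
    (sup_le (zpowers_le.mpr hz) (le_upperCentralSeriesStep_of_le le_rfl))

theorem zpowers_sup_gammaSubgroup_normal {n : ℕ} (hn : 1 ≤ n) {z : G}
    (hz : z ∈ gammaSubgroup G n) : (zpowers z ⊔ gammaSubgroup G (n + 1)).Normal :=
  zpowers_sup_normal (gammaSubgroup_le_upperCentralSeriesStep hn le_rfl hz)

/-- A Nakayama principle: feeding the hypothesis into itself pushes the second factor down to
γ_{n+k} for every `k`, and nilpotency makes it vanish. -/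
theorem gammaSubgroup_le_of_le_sup_succ [Group.IsNilpotent G] {M : Subgroup G} [M.Normal] {n : ℕ}
    (hn : 1 ≤ n) (h : gammaSubgroup G n ≤ M ⊔ gammaSubgroup G (n + 1)) : gammaSubgroup G n ≤ M := by
  have step : ∀ k, gammaSubgroup G n ≤ M ⊔ gammaSubgroup G (n + k) := by
    intro k
    induction k with
    | zero => exact le_sup_right
    | succ k ih =>
      refine h.trans (sup_le le_sup_left ?_)
      refine gammaSubgroup_succ_le_of_le_upperCentralSeriesStep hn (ih.trans (sup_le ?_ ?_))
      · exact le_upperCentralSeriesStep_of_le le_sup_left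
      · exact gammaSubgroup_le_upperCentralSeriesStep (by omega) le_sup_right
  obtain ⟨c, hc⟩ := Subgroup.nilpotent_iff_lowerCentralSeries.mp ‹Group.IsNilpotent G›
  have hbot : gammaSubgroup G (n + (c + 1)) = ⊥ :=
    le_bot_iff.mp ((gammaSubgroup_antitone (by omega : c + 1 ≤ _)).trans hc.le)
  simpa [hbot] using step (c + 1)

theorem gammaSubgroup_eq_bot_of_le_succ [Group.IsNilpotent G] {n : ℕ} (hn : 1 ≤ n)
    (h : gammaSubgroup G n ≤ gammaSubgroup G (n + 1)) : gammaSubgroup G n = ⊥ :=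
  le_bot_iff.mp (gammaSubgroup_le_of_le_sup_succ hn (h.trans le_sup_right))

/-- Maximal subgroups of a nilpotent group are normal, and the quotient, being simple and nilpotent,
is abelian. -/
theorem commutator_le_of_isCoatom [Group.IsNilpotent G] {H : Subgroup G} (hH : IsCoatom H) :
    commutator G ≤ H := by
  have := Group.normalizerCondition_of_isNilpotent (G := G) |>.normal_of_coatom _ hH
  have : IsSimpleGroup (G ⧸ H) := by
    have : Nontrivial (G ⧸ H) := QuotientGroup.nontrivial_iff.mpr hH.1
    refine ⟨fun N hN => ?_⟩
    have hle : H ≤ N.comap (QuotientGroup.mk' H) := by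
      intro h hh
      rw [mem_comap, QuotientGroup.mk'_apply, (QuotientGroup.eq_one_iff h).mpr hh]
      exact one_mem N
    have hs := QuotientGroup.mk'_surjective H
    rcases hH.le_iff.mp hle with h | h
    · right
      rw [← map_comap_eq_self_of_surjective hs N, h, ← MonoidHom.range_eq_map,
        MonoidHom.range_eq_top.mpr hs]
    · left
      rw [← map_comap_eq_self_of_surjective hs N, h, QuotientGroup.map_mk'_self]
  rw [commutator_def, Subgroup.commutator_le]
  intro a _ b _
  rw [← commute_mk_iff]
  exact mul_comm (G := G ⧸ H) _ _

theorem eq_top_of_sup_commutator_eq_top [Finite G] [Group.IsNilpotent G] {K : Subgroup G}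
    (h : K ⊔ commutator G = ⊤) : K = ⊤ := by
  by_contra hK
  obtain ⟨H, hH, hKH⟩ := (eq_top_or_exists_le_coatom K).resolve_left hK
  exact hH.1 (top_le_iff.mp (h ▸ sup_le hKH (commutator_le_of_isCoatom hH)))

theorem relIndex_dvd_of_le_zpowers_sup {N L : Subgroup G} [N.Normal] {z : G} {k : ℕ}
    (hz : z ^ k ∈ N) (hL : L ≤ zpowers z ⊔ N) : N.relIndex L ∣ k := by
  have h := relIndex_ker (K := L) (QuotientGroup.mk' N)
  rw [QuotientGroup.ker_mk'] at h
  rw [h]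
  have hle : L.map (QuotientGroup.mk' N) ≤ zpowers (z : G ⧸ N) := by
    refine (Subgroup.map_mono hL).trans ?_
    rw [Subgroup.map_sup, QuotientGroup.map_mk'_self, sup_bot_eq, MonoidHom.map_zpowers]
    rfl
  refine (card_dvd_of_le hle).trans ?_
  rw [Nat.card_zpowers]
  exact orderOf_dvd_of_pow_eq_one ((QuotientGroup.eq_one_iff (z ^ k)).mpr hz)

/-- If all `k`-th powers lie in the derived subgroup, every factor of the lower central series
has exponent dividing `k`. -/
theorem pow_mem_gammaSubgroup_succ {k : ℕ} (h : ∀ g : G, g ^ k ∈ gammaSubgroup G 2) {n : ℕ}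
    (hn : 1 ≤ n) {z : G} (hz : z ∈ gammaSubgroup G n) : z ^ k ∈ gammaSubgroup G (n + 1) := by
  induction n, hn using Nat.le_induction generalizing z with
  | base => exact h z
  | succ n hn ih =>
    have hcomm : ∀ (g : G) {w : G}, w ∈ gammaSubgroup G (n + 1) →
        Commute (g : G ⧸ gammaSubgroup G (n + 1 + 1)) w := fun g w hw =>
      commute_mk_iff.mpr (commutatorElement_mem_gammaSubgroup_succ (by omega) g hw)
    obtain ⟨n, rfl⟩ := Nat.exists_eq_add_of_le' hn
    rw [gammaSubgroup_add_two, Subgroup.commutator_comm] at hz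
    rw [← QuotientGroup.eq_one_iff, QuotientGroup.mk_pow]
    induction hz using Subgroup.closure_induction with
    | mem u hu =>
      obtain ⟨g, -, w, hw, rfl⟩ := hu
      have hu : ⁅g, w⁆ ∈ gammaSubgroup G (n + 1 + 1) :=
        commutatorElement_mem_gammaSubgroup_succ (by omega) g hw
      have e : ((⁅g, w⁆ * w : G) : G ⧸ gammaSubgroup G (n + 1 + 1 + 1)) = (g * w * g⁻¹ : G) := by
        congr 1; simp [commutatorElement_def]
      -- `⁅g, w⁆ * w` is a conjugate of `w`, and `w ^ k` is central here by induction; expanding the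
      -- power then kills `⁅g, w⁆ ^ k`.
      have e2 : ((⁅g, w⁆ * w : G) : G ⧸ gammaSubgroup G (n + 1 + 1 + 1)) ^ k = (w : G ⧸ _) ^ k := by
        rw [e, ← QuotientGroup.mk_pow, conj_pow]
        have := hcomm g (ih hw)
        rw [QuotientGroup.mk_mul, QuotientGroup.mk_mul, this.eq, QuotientGroup.mk_inv,
          mul_inv_cancel_right, QuotientGroup.mk_pow]
      rw [QuotientGroup.mk_mul, ((hcomm w hu).symm).mul_pow, mul_eq_right] at e2
      exact e2
    | one => simp
    | mul a b ha hb iha ihb =>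
      rw [QuotientGroup.mk_mul, Commute.mul_pow, iha, ihb, one_mul]
      refine hcomm a ?_
      rw [gammaSubgroup_add_two, Subgroup.commutator_comm]
      exact hb
    | inv a ha iha => rw [QuotientGroup.mk_inv, inv_pow, iha, inv_one]

end Basics

/-! ### Generating pairs, maximal subgroups and their rank. -/

section TwoGenerator

variable {G : Type*} [Group G]

theorem isCoatom_of_index_prime {H : Subgroup G} (h : H.index.Prime) : IsCoatom H := by
  refine ⟨fun hH => ?_, fun K hK => ?_⟩
  · rw [hH, index_top] at h
    exact Nat.not_prime_one h
  · have hmul := relIndex_mul_index hK.le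
    rcases h.eq_one_or_self_of_dvd _ (Dvd.intro_left _ hmul) with h1 | h1
    · exact index_eq_one.mp h1
    · rw [h1] at hmul
      have : H.relIndex K = 1 := Nat.eq_of_mul_eq_mul_right h.pos (by rw [hmul, one_mul])
      exact absurd (relIndex_eq_one.mp this) hK.not_ge

theorem not_zpowers_sup_commutator_eq_top [Finite G] [Group.IsNilpotent G]
    (hab : (commutator G).index = 9) (hcard : 81 ≤ Nat.card G) (g : G) :
    zpowers g ⊔ commutator G ≠ ⊤ := by
  intro h
  have hg := eq_top_of_sup_commutator_eq_top h
  have : commutator G = ⊥ := by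
    rw [commutator_def, ← hg, Subgroup.commutator_self_eq_bot_iff]
    infer_instance
  rw [this, index_bot] at hab
  omega

theorem pow_three_mem_gammaSubgroup_two [Finite G] [Group.IsNilpotent G]
    (hab : (commutator G).index = 9) (hcard : 81 ≤ Nat.card G) (g : G) :
    g ^ 3 ∈ gammaSubgroup G 2 := by
  by_contra hg
  apply not_zpowers_sup_commutator_eq_top hab hcard g
  have hcardQ : Nat.card (G ⧸ commutator G) = 9 := hab
  have hord : orderOf (g : G ⧸ commutator G) = 3 ^ 2 := by
    refine orderOf_eq_prime_pow ?_ ?_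
    · rw [pow_one, ← QuotientGroup.mk_pow, QuotientGroup.eq_one_iff]
      exact hg
    · have := pow_card_eq_one' (x := (g : G ⧸ commutator G))
      rwa [hcardQ] at this
  have htop : zpowers (g : G ⧸ commutator G) = ⊤ := by
    apply eq_top_of_card_eq
    rw [Nat.card_zpowers, hord, hcardQ]
    norm_num
  have hmap : (zpowers g).map (QuotientGroup.mk' (commutator G)) = ⊤ := by
    rw [MonoidHom.map_zpowers]
    exact htop
  have := congrArg (comap (QuotientGroup.mk' (commutator G))) hmap
  rwa [comap_map_eq, QuotientGroup.ker_mk', comap_top] at this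

theorem isCoatom_zpowers_sup_commutator [Finite G] [Group.IsNilpotent G]
    (hab : (commutator G).index = 9) (hcard : 81 ≤ Nat.card G) {h : G} (hh : h ∉ commutator G) :
    IsCoatom (zpowers h ⊔ commutator G) := by
  apply isCoatom_of_index_prime
  have h3 : (commutator G).relIndex (zpowers h ⊔ commutator G) ∣ 3 :=
    relIndex_dvd_of_le_zpowers_sup (pow_three_mem_gammaSubgroup_two hab hcard h) le_rfl
  have hmul := relIndex_mul_index (le_sup_right : commutator G ≤ zpowers h ⊔ commutator G)
  rcases (Nat.dvd_prime Nat.prime_three).mp h3 with h1 | h1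
  · exact absurd (relIndex_eq_one.mp h1 (mem_sup_left (mem_zpowers h))) hh
  · rw [h1, hab] at hmul
    have : (zpowers h ⊔ commutator G).index = 3 := by omega
    rw [this]
    exact Nat.prime_three

theorem closure_pair_eq_top_of_notMem [Finite G] [Group.IsNilpotent G]
    (hab : (commutator G).index = 9) (hcard : 81 ≤ Nat.card G) {h g : G} (hh : h ∉ commutator G)
    (hg : g ∉ zpowers h ⊔ commutator G) : closure {h, g} = ⊤ := by
  apply eq_top_of_sup_commutator_eq_top
  refine (isCoatom_zpowers_sup_commutator hab hcard hh).2 _ (lt_of_le_of_ne ?_ ?_)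
  · exact sup_le_sup_right (zpowers_le.mpr (subset_closure (by simp))) _
  · intro e
    rw [e] at hg
    exact hg (mem_sup_left (subset_closure (by simp)))

theorem notMem_commutator_of_closure_pair_eq_top [Finite G] [Group.IsNilpotent G]
    (hab : (commutator G).index = 9) (hcard : 81 ≤ Nat.card G) {h g : G}
    (hhg : closure {h, g} = ⊤) : h ∉ commutator G := by
  intro hh
  apply not_zpowers_sup_commutator_eq_top hab hcard g
  rw [eq_top_iff, ← hhg, closure_le]
  rintro _ (rfl | rfl)
  · exact mem_sup_right hh
  · exact mem_sup_left (mem_zpowers _)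

theorem exists_closure_pair_eq_top [Finite G] [Group.IsNilpotent G]
    (hab : (commutator G).index = 9) (hcard : 81 ≤ Nat.card G) :
    ∃ x y : G, closure {x, y} = ⊤ := by
  have h1 : commutator G ≠ ⊤ := by
    intro h
    rw [h, index_top] at hab
    omega
  obtain ⟨x, hx⟩ := SetLike.exists_not_mem_of_ne_top _ h1 rfl
  obtain ⟨y, hy⟩ := SetLike.exists_not_mem_of_ne_top _
    (not_zpowers_sup_commutator_eq_top hab hcard x) rfl
  exact ⟨x, y, closure_pair_eq_top_of_notMem hab hcard hx hy⟩

theorem exists_eq_zpowers_sup_commutator_of_isCoatom [Finite G] [Group.IsNilpotent G]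
    (hab : (commutator G).index = 9) (hcard : 81 ≤ Nat.card G) {H : Subgroup G} (hH : IsCoatom H) :
    ∃ h g : G, closure {h, g} = ⊤ ∧ H = zpowers h ⊔ commutator G := by
  have hle := commutator_le_of_isCoatom hH
  obtain ⟨x, y, hxy⟩ := exists_closure_pair_eq_top hab hcard
  have hne : ∃ h ∈ H, h ∉ commutator G := by
    by_contra! hcon
    have heq : H = commutator G := le_antisymm hcon hle
    have hx := notMem_commutator_of_closure_pair_eq_top hab hcard hxy
    refine (isCoatom_zpowers_sup_commutator hab hcard hx).1 (hH.2 _ ?_)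
    rw [heq]
    exact lt_of_le_of_ne le_sup_right fun e => hx (by rw [e]; exact mem_sup_left (mem_zpowers x))
  obtain ⟨h, hhH, hh⟩ := hne
  have heq : H = zpowers h ⊔ commutator G :=
    ((isCoatom_zpowers_sup_commutator hab hcard hh).le_iff.mp
      (sup_le (zpowers_le.mpr hhH) hle)).resolve_left hH.1
  obtain ⟨g, hg⟩ := SetLike.exists_not_mem_of_ne_top _ hH.1 rfl
  exact ⟨h, g, closure_pair_eq_top_of_notMem hab hcard hh (heq ▸ hg), heq⟩

theorem mem_normalizer_of_map_conj_le [Finite G] {K : Subgroup G} {g : G}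
    (h : ∀ k ∈ K, g * k * g⁻¹ ∈ K) : g ∈ normalizer (K : Set G) := by
  rw [mem_normalizer_iff_map_conj_eq]
  refine eq_of_le_of_card_ge ?_ ?_
  · rintro _ ⟨k, hk, rfl⟩
    exact h k hk
  · exact (card_map_of_injective (MulAut.conj g).injective).ge

/-- In a group generated by `h` and `g`, a normal subgroup containing `h` contains the derived
subgroup. -/
theorem commutator_le_of_mem_of_closure_pair_eq_top {K : Subgroup G} [K.Normal] {h g : G}
    (hhg : closure {h, g} = ⊤) (hh : h ∈ K) : commutator G ≤ K := by
  have hK := le_upperCentralSeriesStep_of_le (le_refl K)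
  refine gammaSubgroup_succ_le_of_le_upperCentralSeriesStep (n := 1) le_rfl ?_
  rw [gammaSubgroup_one, ← hhg, closure_le]
  rintro _ (rfl | rfl)
  · exact hK hh
  · refine mem_upperCentralSeriesStep_of_closure_eq_top hhg ?_
    rintro _ (rfl | rfl)
    · rw [← commutatorElement_inv, inv_mem_iff]
      exact mem_upperCentralSeriesStep_iff.mp (hK hh) _
    · rw [commutatorElement_self]
      exact one_mem K

/-- The conjugates of `h` under the powers of `g` generate the maximal subgroup containing `h`
modulo its derived subgroup. -/
theorem zpowers_sup_commutator_le_closure_conj [Finite G] {h g : G} (hhg : closure {h, g} = ⊤)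
    (hcube : g ^ 3 ∈ commutator G) :
    zpowers h ⊔ commutator G ≤ closure {h, g * h * g⁻¹, g ^ 2 * h * (g ^ 2)⁻¹} ⊔
      ⁅zpowers h ⊔ commutator G, zpowers h ⊔ commutator G⁆ := by
  set H := zpowers h ⊔ commutator G with hHdef
  set K := closure {h, g * h * g⁻¹, g ^ 2 * h * (g ^ 2)⁻¹} ⊔ ⁅H, H⁆ with hKdef
  have hHn : H.Normal := Normal.of_commutator_le _ le_sup_right
  have hhH : h ∈ H := mem_sup_left (mem_zpowers h)
  have hh : h ∈ K := mem_sup_left (subset_closure (by simp))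
  have hcomm : ∀ a ∈ H, ∀ b ∈ H, ⁅a, b⁆ ∈ K := fun a ha b hb =>
    mem_sup_right (commutator_mem_commutator ha hb)
  have hKH : K ≤ H := by
    refine sup_le ?_ (Subgroup.commutator_le_self H)
    rw [closure_le]
    rintro _ (rfl | rfl | rfl)
    · exact hhH
    · exact hHn.conj_mem _ hhH _
    · exact hHn.conj_mem _ hhH _
  have hKn : K.Normal := by
    rw [← normalizer_eq_top_iff, eq_top_iff, ← hhg, closure_le, Set.insert_subset_iff,
      Set.singleton_subset_iff]
    constructor
    · refine mem_normalizer_of_map_conj_le fun k hk => ?_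
      have := K.mul_mem (hcomm _ hhH _ (hKH hk)) hk
      rwa [commutatorElement_def, inv_mul_cancel_right] at this
    · refine mem_normalizer_of_map_conj_le fun k hk => ?_
      -- Conjugation by `g` permutes the three generators cyclically up to an element of `⁅H, H⁆`:
      -- the last goes to the conjugate of `h` by `g ^ 3 ∈ H`.
      have hle : K ≤ K.comap (MulAut.conj g).toMonoidHom := by
        refine sup_le ?_ ?_
        · rw [closure_le]
          rintro _ (rfl | rfl | rfl)
          · exact mem_sup_left (subset_closure (by simp))
          · refine mem_sup_left (subset_closure ?_)
            simp [pow_two, mul_assoc]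
          · have h3 := K.mul_mem (hcomm (g ^ 3) (mem_sup_right hcube) h hhH) hh
            rw [commutatorElement_def, inv_mul_cancel_right] at h3
            have : g * (g ^ 2 * h * (g ^ 2)⁻¹) * g⁻¹ = g ^ 3 * h * (g ^ 3)⁻¹ := by group
            change g * (g ^ 2 * h * (g ^ 2)⁻¹) * g⁻¹ ∈ K
            rwa [this]
        · intro z hz
          exact mem_sup_right ((inferInstance : (⁅H, H⁆ : Subgroup G).Normal).conj_mem z hz g)
      exact hle hk
  exact sup_le (zpowers_le.mpr hh) (commutator_le_of_mem_of_closure_pair_eq_top hhg hh)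

theorem rank_le_three_of_isCoatom [Finite G] [Group.IsNilpotent G]
    (hab : (commutator G).index = 9) (hcard : 81 ≤ Nat.card G) {H : Subgroup G} (hH : IsCoatom H) :
    Group.rank H ≤ 3 := by
  classical
  obtain ⟨h, g, hhg, rfl⟩ := exists_eq_zpowers_sup_commutator_of_isCoatom hab hcard hH
  have hle := zpowers_sup_commutator_le_closure_conj hhg
    (pow_three_mem_gammaSubgroup_two hab hcard g)
  set H := zpowers h ⊔ commutator G with hHdef
  have hHn : H.Normal := Normal.of_commutator_le _ le_sup_right
  have hhH : h ∈ H := mem_sup_left (mem_zpowers h)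
  let S : Finset H := {⟨h, hhH⟩, ⟨g * h * g⁻¹, hHn.conj_mem _ hhH _⟩,
    ⟨g ^ 2 * h * (g ^ 2)⁻¹, hHn.conj_mem _ hhH _⟩}
  refine (Group.rank_le (S := S) ?_).trans Finset.card_le_three
  apply eq_top_of_sup_commutator_eq_top
  apply map_injective H.subtype_injective
  refine le_antisymm (map_mono le_top) ?_
  rw [Subgroup.map_sup, map_subtype_commutator, MonoidHom.map_closure, ← MonoidHom.range_eq_map,
    range_subtype]
  refine hle.trans (sup_le_sup_right (Subgroup.closure_mono ?_) _)
  rintro _ (rfl | rfl | rfl) <;> simp [S]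

end TwoGenerator

/-! ### The index of γ_3, and cubes lie in γ_3. -/

section Cubes

variable {G : Type*} [Group G]

theorem gammaSubgroup_two_le_zpowers_sup {x y : G} (hxy : closure {x, y} = ⊤) :
    gammaSubgroup G 2 ≤ zpowers ⁅y, x⁆ ⊔ gammaSubgroup G 3 := by
  have hc : ⁅y, x⁆ ∈ gammaSubgroup G 2 :=
    commutatorElement_mem_gammaSubgroup_succ (n := 1) le_rfl y (mem_top x)
  have hn := zpowers_sup_gammaSubgroup_normal (n := 2) (by norm_num) hc
  have hmem : ⁅y, x⁆ ∈ zpowers ⁅y, x⁆ ⊔ gammaSubgroup G (2 + 1) := mem_sup_left (mem_zpowers _)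
  refine gammaSubgroup_succ_le_of_le_upperCentralSeriesStep (n := 1) le_rfl ?_
  rw [gammaSubgroup_one, ← hxy, closure_le]
  rintro z hz
  refine mem_upperCentralSeriesStep_of_closure_eq_top hxy ?_
  rcases hz with rfl | rfl <;> rintro _ (rfl | rfl)
  · rw [commutatorElement_self]; exact one_mem _
  · exact hmem
  · exact inv_mem_iff.mp (by rwa [commutatorElement_inv])
  · rw [commutatorElement_self]; exact one_mem _

/-- Since γ_{n+1} is central modulo `K`, centrality of γ_n modulo `K` need only be tested on the
commutators of `d` with the two generators. -/
theorem gammaSubgroup_succ_le_of_zpowers {x y : G} (hxy : closure {x, y} = ⊤) {n : ℕ} (hn : 1 ≤ n)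
    {d : G} (hd : gammaSubgroup G n ≤ zpowers d ⊔ gammaSubgroup G (n + 1)) {K : Subgroup G}
    [K.Normal] (hK : gammaSubgroup G (n + 2) ≤ K) (hx : ⁅x, d⁆ ∈ K) (hy : ⁅y, d⁆ ∈ K) :
    gammaSubgroup G (n + 1) ≤ K := by
  refine gammaSubgroup_succ_le_of_le_upperCentralSeriesStep hn (hd.trans (sup_le ?_ ?_))
  · rw [zpowers_le]
    refine mem_upperCentralSeriesStep_of_closure_eq_top hxy ?_
    rintro _ (rfl | rfl)
    exacts [hx, hy]
  · exact gammaSubgroup_le_upperCentralSeriesStep (by omega) hK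

theorem mul_pow_three_of_conj_eq {y c q : G} (h : y * c * y⁻¹ = q * c) (hqy : Commute q y)
    (hqc : Commute q c) : (c * y) ^ 3 = q ^ 3 * c ^ 3 * y ^ 3 := by
  have h1 : ∀ z, y * (c * z) = q * (c * (y * z)) := fun z => by
    simpa only [mul_assoc] using congrArg (· * z) (mul_inv_eq_iff_eq_mul.mp h)
  have h2 : ∀ z, y * (q * z) = q * (y * z) := fun z => hqy.symm.left_comm z
  have h3 : ∀ z, c * (q * z) = q * (c * z) := fun z => hqc.symm.left_comm z
  simp only [pow_succ, pow_zero, one_mul, mul_assoc, h1, h2, h3]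

theorem index_gammaSubgroup_three [Finite G] [Group.IsNilpotent G]
    (hab : (commutator G).index = 9) (hcard : 81 ≤ Nat.card G) :
    (gammaSubgroup G 3).index = 27 := by
  obtain ⟨x, y, hxy⟩ := exists_closure_pair_eq_top hab hcard
  have hc : ⁅y, x⁆ ∈ gammaSubgroup G 2 :=
    commutatorElement_mem_gammaSubgroup_succ (n := 1) le_rfl y (mem_top x)
  have hc3 := pow_mem_gammaSubgroup_succ (pow_three_mem_gammaSubgroup_two hab hcard)
    (by norm_num) hc
  have hdvd := relIndex_dvd_of_le_zpowers_sup hc3 (gammaSubgroup_two_le_zpowers_sup hxy)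
  have hmul := relIndex_mul_index (gammaSubgroup_antitone (G := G) (by norm_num : 2 ≤ 3))
  rw [gammaSubgroup_two, hab] at hmul
  rcases (Nat.dvd_prime Nat.prime_three).mp hdvd with h1 | h1
  · have := gammaSubgroup_eq_bot_of_le_succ (by norm_num) (relIndex_eq_one.mp h1)
    rw [gammaSubgroup_two] at this
    rw [this, index_bot] at hab
    omega
  · rw [gammaSubgroup_two] at h1
    rw [← hmul]
    simp only [Nat.reduceAdd] at h1
    rw [h1]

theorem not_gammaSubgroup_three_le_four [Finite G] [Group.IsNilpotent G]
    (hab : (commutator G).index = 9) (hcard : 81 ≤ Nat.card G) :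
    ¬ gammaSubgroup G 3 ≤ gammaSubgroup G 4 := by
  intro h
  have h27 := index_gammaSubgroup_three hab hcard
  rw [gammaSubgroup_eq_bot_of_le_succ (by norm_num) h, index_bot] at h27
  omega

theorem relIndex_gammaSubgroup_three_two [Finite G] [Group.IsNilpotent G]
    (hab : (commutator G).index = 9) (hcard : 81 ≤ Nat.card G) :
    (gammaSubgroup G 3).relIndex (gammaSubgroup G 2) = 3 := by
  have hmul := relIndex_mul_index (gammaSubgroup_antitone (G := G) (by norm_num : 2 ≤ 3))
  rw [index_gammaSubgroup_three hab hcard, gammaSubgroup_two, hab] at hmul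
  rw [gammaSubgroup_two]
  omega

theorem gammaSubgroup_two_le_of_notMem [Finite G] [Group.IsNilpotent G]
    (hab : (commutator G).index = 9) (hcard : 81 ≤ Nat.card G) {z : G} (hz : z ∈ gammaSubgroup G 2)
    (hz3 : z ∉ gammaSubgroup G 3) : gammaSubgroup G 2 ≤ zpowers z ⊔ gammaSubgroup G 3 := by
  have h3 := relIndex_gammaSubgroup_three_two hab hcard
  have hle : zpowers z ⊔ gammaSubgroup G 3 ≤ gammaSubgroup G 2 :=
    sup_le (zpowers_le.mpr hz) (gammaSubgroup_antitone (by norm_num))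
  have hmul := relIndex_mul_relIndex (gammaSubgroup G 3) _ _ le_sup_right hle
  rw [h3] at hmul
  rcases (Nat.dvd_prime Nat.prime_three).mp (Dvd.intro _ hmul) with h1 | h1
  · exact absurd (relIndex_eq_one.mp h1 (mem_sup_left (mem_zpowers z))) hz3
  · rw [h1] at hmul
    exact relIndex_eq_one.mp (by omega)

/-- If `g ^ 3` generated γ_2 modulo γ_3, then `g` would centralize γ_2 modulo γ_4. It then suffices
that a second generator `y` commutes with `g ^ 3` modulo γ_4, since this gives the contradiction γ_3
≤ γ_4. -/
theorem pow_three_mem_gammaSubgroup_three [Finite G] [Group.IsNilpotent G]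
    (hab : (commutator G).index = 9) (hcard : 81 ≤ Nat.card G) (g : G) :
    g ^ 3 ∈ gammaSubgroup G 3 := by
  have hcube := pow_three_mem_gammaSubgroup_two hab hcard
  by_cases hg : g ∈ gammaSubgroup G 2
  · exact pow_mem_gammaSubgroup_succ hcube (by norm_num) hg
  obtain ⟨y, hy⟩ := SetLike.exists_not_mem_of_ne_top _
    (not_zpowers_sup_commutator_eq_top hab hcard g) rfl
  have hgy := closure_pair_eq_top_of_notMem hab hcard hg hy
  by_contra hg3
  have hle := gammaSubgroup_two_le_of_notMem hab hcard (hcube g) hg3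
  have hcen : ∀ (a : G) {z : G}, z ∈ gammaSubgroup G 3 → Commute (a : G ⧸ gammaSubgroup G 4) z :=
    fun a z hz => commute_mk_iff.mpr (commutatorElement_mem_gammaSubgroup_succ (by norm_num) a hz)
  have hcomm : ∀ {a u : G}, gammaSubgroup G 2 ≤ zpowers (a ^ 3) ⊔ gammaSubgroup G 3 →
      u ∈ gammaSubgroup G 2 → Commute (a : G ⧸ gammaSubgroup G 4) u := by
    intro a u ha hu
    have : zpowers (a ^ 3) ⊔ gammaSubgroup G 3 ≤
        (centralizer {(a : G ⧸ gammaSubgroup G 4)}).comap (QuotientGroup.mk' _) := by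
      refine sup_le ?_ ?_
      · rw [zpowers_le, mem_comap, mem_centralizer_singleton_iff]
        exact (Commute.pow_self (a : G ⧸ gammaSubgroup G 4) 3).eq
      · intro z hz
        rw [mem_comap, mem_centralizer_singleton_iff]
        exact (hcen a hz).symm.eq
    have := this (ha hu)
    rw [mem_comap, mem_centralizer_singleton_iff] at this
    exact this.symm
  refine not_gammaSubgroup_three_le_four hab hcard
    (gammaSubgroup_succ_le_of_zpowers hgy (by norm_num) hle le_rfl ?_ ?_)
  · rw [(Commute.self_pow g 3).commutator_eq]
    exact one_mem _
  rw [← commute_mk_iff]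
  -- If `y ^ 3 ∈ γ_3` it is central modulo γ_4, and cubing `g y g⁻¹ = ⁅g, y⁆ y` gives `⁅g, y⁆ ^ 3 =
  -- 1`; cubing `y g y⁻¹ = ⁅y, g⁆ g` then shows that `y` fixes `g ^ 3`. Otherwise `y ^ 3` also
  -- generates γ_2 modulo γ_3, so `y` too centralizes γ_2 modulo γ_4.
  by_cases hy3 : y ^ 3 ∈ gammaSubgroup G 3
  · have hc : ⁅y, g⁆ ∈ gammaSubgroup G 2 :=
      commutatorElement_mem_gammaSubgroup_succ (n := 1) le_rfl y (mem_top g)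
    have hq : ⁅y, ⁅g, y⁆⁆ ∈ gammaSubgroup G 3 := by
      refine commutatorElement_mem_gammaSubgroup_succ (by norm_num) y ?_
      rw [← commutatorElement_inv]; exact inv_mem hc
    have hq3 := pow_mem_gammaSubgroup_succ hcube (by norm_num) hq
    rw [← QuotientGroup.eq_one_iff, QuotientGroup.mk_pow] at hq3
    have e1 := mul_pow_three_of_conj_eq (y := (y : G ⧸ gammaSubgroup G 4))
      (c := (⁅g, y⁆ : G)) (q := (⁅y, ⁅g, y⁆⁆ : G))
      (by rw [← QuotientGroup.mk_mul, ← QuotientGroup.mk_inv, ← QuotientGroup.mk_mul,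
            ← QuotientGroup.mk_mul]
          congr 1; simp [commutatorElement_def, mul_assoc])
      (hcen y hq).symm (hcen _ hq).symm
    have e2 : ((⁅g, y⁆ : G) : G ⧸ gammaSubgroup G 4) * y =
        g * y * (g : G ⧸ gammaSubgroup G 4)⁻¹ := by
      change ((⁅g, y⁆ * y : G) : G ⧸ gammaSubgroup G 4) = (g * y * g⁻¹ : G)
      congr 1; simp [commutatorElement_def]
    have hc3 : ((⁅g, y⁆ : G) : G ⧸ gammaSubgroup G 4) ^ 3 = 1 := by
      rw [hq3, one_mul, e2, conj_pow, ← QuotientGroup.mk_pow, (hcen g hy3).eq,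
        mul_inv_cancel_right] at e1
      exact (right_eq_mul.mp e1)
    have e3 : (y : G ⧸ gammaSubgroup G 4) * g * (y : G ⧸ gammaSubgroup G 4)⁻¹ =
        (⁅y, g⁆ : G) * g := by
      change ((y * g * y⁻¹ : G) : G ⧸ gammaSubgroup G 4) = (⁅y, g⁆ * g : G)
      congr 1; simp [commutatorElement_def]
    have e4 := congrArg (· ^ 3) e3
    have hc3' : ((⁅y, g⁆ : G) : G ⧸ gammaSubgroup G 4) ^ 3 = 1 := by
      rw [← commutatorElement_inv, QuotientGroup.mk_inv, inv_pow, hc3, inv_one]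
    rw [conj_pow, (hcomm hle hc).symm.mul_pow, hc3', one_mul] at e4
    rw [QuotientGroup.mk_pow]
    exact mul_inv_eq_iff_eq_mul.mp e4
  · exact hcomm (gammaSubgroup_two_le_of_notMem hab hcard (hcube y) hy3) (hcube g)

end Cubes

/-! ### Groups of exponent three, and γ_3 ≤ `G^3`. -/

section ExponentThree

/-- The relation `(ab)^3 = 1` reads `bab = a⁻¹b⁻¹a⁻¹`; applying it twice and contracting squares by
`y^2 = y⁻¹` gives the claim. -/
theorem commute_conj_of_pow_three_eq_one {Q : Type*} [Group Q] (h : ∀ a : Q, a ^ 3 = 1) (x y : Q) :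
    Commute x (y⁻¹ * x * y) := by
  have hinv : ∀ a : Q, a * a = a⁻¹ := fun a => by
    rw [eq_inv_iff_mul_eq_one, ← h a]; simp [pow_succ]
  have h1 : ∀ a b : Q, b * a * b = a⁻¹ * b⁻¹ * a⁻¹ := fun a b => by
    have := h (a * b)
    simp only [pow_succ, pow_zero, one_mul] at this
    calc b * a * b = a⁻¹ * (a * b * (a * b) * (a * b)) * b⁻¹ * a⁻¹ := by group
      _ = _ := by rw [this]; group
  have h2 : x * y⁻¹ * x = y * x⁻¹ * y := by simpa using (h1 x⁻¹ y).symm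
  have key : x * (y⁻¹ * x * y) * x⁻¹ = y⁻¹ * x * y := by
    calc x * (y⁻¹ * x * y) * x⁻¹ = (x * y⁻¹ * x) * y * x⁻¹ := by group
      _ = y * x⁻¹ * (y * y) * x⁻¹ := by rw [h2]; group
      _ = y * (x⁻¹ * y⁻¹ * x⁻¹) := by rw [hinv y]; group
      _ = (y * y) * x * y := by rw [← h1 x y]; group
      _ = y⁻¹ * x * y := by rw [hinv y]
  exact mul_inv_eq_iff_eq_mul.mp key

theorem commute_commutatorElement_of_pow_three_eq_one {Q : Type*} [Group Q]
    (h : ∀ a : Q, a ^ 3 = 1) (x y : Q) : Commute x ⁅y, x⁆ := by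
  have := commute_conj_of_pow_three_eq_one h x y⁻¹
  rw [inv_inv] at this
  exact this.mul_right (Commute.refl x).inv_right

variable {G : Type*} [Group G]

instance powerSubgroup_normal (n : ℕ) : (powerSubgroup G n).Normal := by
  refine ⟨fun z hz g => ?_⟩
  induction hz using Subgroup.closure_induction with
  | mem u hu =>
    obtain ⟨w, rfl⟩ := hu
    exact subset_closure ⟨g * w * g⁻¹, conj_pow⟩
  | one => simp
  | mul a b _ _ ha hb => simpa [mul_assoc] using mul_mem ha hb
  | inv a _ ha => simpa [mul_assoc] using inv_mem ha

theorem gammaSubgroup_three_le_powerSubgroup [Group.IsNilpotent G] {x y : G}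
    (hxy : closure {x, y} = ⊤) : gammaSubgroup G 3 ≤ powerSubgroup G 3 := by
  apply gammaSubgroup_le_of_le_sup_succ (by norm_num)
  have hexp : ∀ a : G ⧸ powerSubgroup G 3, a ^ 3 = 1 := fun a => by
    obtain ⟨a, rfl⟩ := QuotientGroup.mk_surjective a
    exact (QuotientGroup.eq_one_iff (a ^ 3)).mpr (subset_closure ⟨a, rfl⟩)
  refine gammaSubgroup_succ_le_of_zpowers hxy (by norm_num) (gammaSubgroup_two_le_zpowers_sup hxy)
    le_sup_right (mem_sup_left ?_) (mem_sup_left ?_)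
  · exact commute_mk_iff.mp (commute_commutatorElement_of_pow_three_eq_one hexp x y)
  · rw [← commute_mk_iff, ← commutatorElement_inv x y, QuotientGroup.mk_inv]
    exact (commute_commutatorElement_of_pow_three_eq_one hexp y x).inv_right

theorem powerSubgroup_three_eq_gammaSubgroup_three [Finite G] [Group.IsNilpotent G]
    (hab : (commutator G).index = 9) (hcard : 81 ≤ Nat.card G) :
    powerSubgroup G 3 = gammaSubgroup G 3 := by
  obtain ⟨x, y, hxy⟩ := exists_closure_pair_eq_top hab hcard
  refine le_antisymm ?_ (gammaSubgroup_three_le_powerSubgroup hxy)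
  rw [powerSubgroup, closure_le]
  rintro _ ⟨g, rfl⟩
  exact pow_three_mem_gammaSubgroup_three hab hcard g

end ExponentThree

/-! ### Collection formulas and the linear algebra behind (3). -/

section Collection

variable {Q : Type*} [Group Q]

/-- Relations for the action of `g` on the abelian normal subgroup generated by the conjugates
of `h` when the cube of `g` acts trivially. -/
theorem zpow_eq_one_of_conj_relations {g h c r t m : Q} {i : ℤ} (h1 : MulAut.conj g h = c * h)
    (h2 : MulAut.conj g c = r * c) (h3 : MulAut.conj g r = t * r) (hch : Commute c h)
    (hrc : Commute r c) (htr : Commute t r) (hg3 : Commute (g ^ 3) h)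
    (hc3 : Commute g (c ^ 3)) (hm : Commute g m) (hh : h ^ 3 = r ^ i * m) :
    t ^ (i + 1) = 1 ∧ t ^ 3 = 1 := by
  have hfix : ∀ {a : Q}, Commute g a → MulAut.conj g a = a := fun {a} ha => by
    rw [MulAut.conj_apply, ha.eq, mul_inv_cancel_right]
  have hr3 : r ^ 3 = 1 := by
    -- `g` fixes `c ^ 3`, whereas conjugation by `g` multiplies it by `r ^ 3`.
    have := hfix hc3
    rw [map_pow, h2, hrc.mul_pow] at this
    exact mul_eq_right.mp this
  have ht3 : t ^ 3 = 1 := by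
    have := congrArg (MulAut.conj g) hr3
    rw [map_pow, h3, htr.mul_pow, hr3, map_one, mul_one] at this
    exact this
  have hci : c ^ 3 = t ^ i := by
    have := congrArg (MulAut.conj g) hh
    rw [map_pow, h1, hch.mul_pow, map_mul, map_zpow, h3, htr.mul_zpow, hfix hm, mul_assoc, ← hh]
      at this
    exact mul_right_cancel this
  -- The binomial expansion of a threefold conjugation. As `g ^ 3` acts trivially and `c ^ 3 = t ^
  -- i`, what remains is `t * t ^ i = 1`.
  have hconj : MulAut.conj g (MulAut.conj g (MulAut.conj g h)) = t * r ^ 3 * c ^ 3 * h := by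
    simp only [h1, h2, h3, map_mul]
    have hrc' : ∀ z, c * (r * z) = r * (c * z) := fun z => hrc.symm.left_comm z
    simp only [pow_succ, pow_zero, one_mul, mul_assoc, hrc']
  have hg : MulAut.conj g (MulAut.conj g (MulAut.conj g h)) = h := by
    have : MulAut.conj g (MulAut.conj g (MulAut.conj g h)) = g ^ 3 * h * (g ^ 3)⁻¹ := by
      simp only [MulAut.conj_apply, pow_succ, pow_zero, one_mul, mul_inv_rev, mul_assoc]
    rw [this, hg3.eq, mul_inv_cancel_right]
  rw [hg, hr3, mul_one, hci] at hconj
  refine ⟨?_, ht3⟩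
  rw [add_comm, zpow_one_add]
  exact right_eq_mul.mp hconj

/-- The cube of a product in a group of class three whose terms of the lower central series
after the first have exponent three. -/
theorem mul_pow_three_of_conj_relations {x y c p q : Q} (hc : y * x = c * x * y)
    (hxc : x * c = p * c * x) (hyc : y * c = q * c * y) (hp : ∀ z, Commute p z)
    (hq : ∀ z, Commute q z) (hc3 : c ^ 3 = 1) (hp3 : p ^ 3 = 1) (hq3 : q ^ 3 = 1) :
    (y * x) ^ 3 = p⁻¹ * q * x ^ 3 * y ^ 3 := by
  have a1 : ∀ z, y * (x * z) = c * (x * (y * z)) := fun z => by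
    simpa only [mul_assoc] using congrArg (· * z) hc
  have a2 : ∀ z, x * (c * z) = p * (c * (x * z)) := fun z => by
    simpa only [mul_assoc] using congrArg (· * z) hxc
  have a3 : ∀ z, y * (c * z) = q * (c * (y * z)) := fun z => by
    simpa only [mul_assoc] using congrArg (· * z) hyc
  have a6 : ∀ z, c * (p * z) = p * (c * z) := fun z => (hp c).symm.left_comm z
  have a7 : ∀ z, x * (q * z) = q * (x * z) := fun z => (hq x).symm.left_comm z
  have a8 : ∀ z, y * (q * z) = q * (y * z) := fun z => (hq y).symm.left_comm z
  have a9 : ∀ z, c * (q * z) = q * (c * z) := fun z => (hq c).symm.left_comm z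
  have a10 : ∀ z, q * (p * z) = p * (q * z) := fun z => (hp q).symm.left_comm z
  have a0 : y * x = c * (x * y) := by rw [hc, mul_assoc]
  have c3 : ∀ z, c * (c * (c * z)) = z := fun z => by
    have := congrArg (· * z) hc3
    simpa only [pow_succ, pow_zero, one_mul, mul_assoc] using this
  have p3 : ∀ z, p * (p * (p * z)) = z := fun z => by
    have := congrArg (· * z) hp3
    simpa only [pow_succ, pow_zero, one_mul, mul_assoc] using this
  have q3 : ∀ z, q * (q * (q * z)) = z := fun z => by
    have := congrArg (· * z) hq3
    simpa only [pow_succ, pow_zero, one_mul, mul_assoc] using this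
  rw [eq_comm, mul_assoc, mul_assoc, inv_mul_eq_iff_eq_mul]
  -- Both sides are collected into the order `p, q, c, x, y`.
  simp only [pow_succ, pow_zero, one_mul, mul_assoc, a0, a1, a2, a3, a6, a7, a8, a9, a10,
    c3, p3, q3]

/-- Eliminating `X` and `Y` puts `(a - b - 1) • p` in the span of `p + q` and `(a - b + 1) • q` in
that of `p - q`. The two coefficients differ by 2, so they are not both divisible by 3; whichever is
not is invertible modulo 3. -/
theorem exists_eq_zsmul_add_or_sub {A : Type*} [AddCommGroup A] {p q X Y : A} {a b e f : ℤ}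
    (hp : (3 : ℤ) • p = 0) (hq : (3 : ℤ) • q = 0) (h1 : X + q = a • p) (h2 : Y - p = b • q)
    (h3 : -p + q + X + Y + q = e • (p + q)) (h4 : p + q + X - Y + q = f • (p - q)) :
    (∃ k : ℤ, k • (p + q) = q) ∨ ∃ k : ℤ, k • (p - q) = q := by
  have hX : X = a • p - q := by rw [← h1]; abel
  have hY : Y = b • q + p := by rw [← h2]; abel
  subst hX hY
  have e1 : (a - b - 1) • p = (e - b - 1) • (p + q) := by
    linear_combination (norm := module) h3
  have e2 : (a - b + 1) • q = (f - a) • (p - q) := by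
    linear_combination (norm := module) h4
  obtain ⟨k, hk | hk | hk⟩ : ∃ k : ℤ, a - b - 1 = 3 * k ∨ a - b - 1 = 3 * k + 1 ∨
      a - b - 1 = 3 * k + 2 := ⟨(a - b - 1) / 3, by omega⟩
  · right
    rw [show a - b + 1 = 3 * k + 2 by omega] at e2
    exact ⟨-(f - a), by linear_combination (norm := module) e2 + (-k - 1) • hq⟩
  · left
    rw [hk] at e1
    exact ⟨1 - (e - b - 1), by linear_combination (norm := module) e1 - k • hp⟩
  · left
    rw [hk] at e1
    exact ⟨1 + (e - b - 1), by linear_combination (norm := module) (k + 1) • hp - e1⟩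

end Collection

/-! ### The derived subgroup of a maximal subgroup `H = ⟨h⟩G'`. -/

section MaximalSubgroups

variable {G : Type*} [Group G]

theorem conj_mk_eq {N : Subgroup G} [N.Normal] (a b : G) :
    MulAut.conj (a : G ⧸ N) (b : G ⧸ N) = (⁅a, b⁆ : G) * (b : G ⧸ N) := by
  change ((a * b * a⁻¹ : G) : G ⧸ N) = ((⁅a, b⁆ * b : G) : G ⧸ N)
  congr 1
  simp [commutatorElement_def]

theorem commutator_closure_le_of_forall {S : Set G} {N : Subgroup G} [N.Normal]
    (h : ∀ a ∈ S, ∀ b ∈ S, ⁅a, b⁆ ∈ N) : ⁅closure S, closure S⁆ ≤ N := by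
  have hcomm : IsMulCommutative (closure (Set.image (QuotientGroup.mk' N) S)) := by
    apply isMulCommutative_closure
    rintro _ ⟨a, ha, rfl⟩ _ ⟨b, hb, rfl⟩
    exact (commute_mk_iff.mpr (h a ha b hb)).eq
  have := Subgroup.commutator_self_eq_bot_iff.mpr hcomm
  rwa [← MonoidHom.map_closure, ← Subgroup.map_commutator, Subgroup.map_eq_bot_iff,
    QuotientGroup.ker_mk'] at this

/-- `H` is generated by `h`, `⁅g, h⁆` and γ_3; as γ_3 is central modulo γ_4, the only commutator
that matters is `⁅h, ⁅g, h⁆⁆`. -/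
theorem commutator_zpowers_sup_le {h g : G} (hhg : closure {h, g} = ⊤) :
    ⁅zpowers h ⊔ commutator G, zpowers h ⊔ commutator G⁆ ≤
      zpowers ⁅h, ⁅g, h⁆⁆ ⊔ gammaSubgroup G 4 := by
  have hc : ⁅g, h⁆ ∈ gammaSubgroup G 2 :=
    commutatorElement_mem_gammaSubgroup_succ (n := 1) le_rfl g (mem_top h)
  have hp : ⁅h, ⁅g, h⁆⁆ ∈ gammaSubgroup G 3 :=
    commutatorElement_mem_gammaSubgroup_succ (by norm_num) h hc
  have hn := zpowers_sup_gammaSubgroup_normal (n := 3) (by norm_num) hp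
  have hle : zpowers h ⊔ commutator G ≤ closure ({h, ⁅g, h⁆} ∪ gammaSubgroup G 3) := by
    refine sup_le (zpowers_le.mpr (subset_closure (by simp))) ?_
    refine (gammaSubgroup_two_le_zpowers_sup hhg).trans (sup_le ?_ ?_)
    · exact zpowers_le.mpr (subset_closure (by simp))
    · exact fun z hz => subset_closure (Or.inr hz)
  refine (Subgroup.commutator_mono hle hle).trans (commutator_closure_le_of_forall ?_)
  have hpm : ⁅h, ⁅g, h⁆⁆ ∈ zpowers ⁅h, ⁅g, h⁆⁆ ⊔ gammaSubgroup G (3 + 1) :=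
    mem_sup_left (mem_zpowers _)
  have h3 : ∀ (a : G) {z : G}, z ∈ gammaSubgroup G 3 →
      ⁅a, z⁆ ∈ zpowers ⁅h, ⁅g, h⁆⁆ ⊔ gammaSubgroup G (3 + 1) := fun a z hz =>
    mem_sup_right (commutatorElement_mem_gammaSubgroup_succ (by norm_num) a hz)
  rintro a ((rfl | rfl) | ha) b ((rfl | rfl) | hb)
  · rw [commutatorElement_self]; exact one_mem _
  · exact hpm
  · exact h3 _ hb
  · exact commutatorElement_mem_comm.mp hpm
  · rw [commutatorElement_self]; exact one_mem _
  · exact h3 _ hb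
  all_goals exact commutatorElement_mem_comm.mp (h3 _ ha)

theorem commutatorElement_mem_commutator_zpowers_sup {h a : G} (ha : a ∈ commutator G) :
    ⁅h, a⁆ ∈ ⁅zpowers h ⊔ commutator G, zpowers h ⊔ commutator G⁆ :=
  commutator_mem_commutator (mem_sup_left (mem_zpowers h)) (mem_sup_right ha)

theorem commutator_zpowers_sup_normal (h : G) :
    (⁅zpowers h ⊔ commutator G, zpowers h ⊔ commutator G⁆ : Subgroup G).Normal := by
  have : (zpowers h ⊔ commutator G).Normal := Normal.of_commutator_le _ le_sup_right
  infer_instance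

theorem gammaSubgroup_three_le_zpowers_sup {h g : G} (hhg : closure {h, g} = ⊤) {M : Subgroup G}
    [M.Normal] (hM : ⁅h, ⁅g, h⁆⁆ ∈ M) (h4 : gammaSubgroup G 4 ≤ M) :
    gammaSubgroup G 3 ≤ zpowers ⁅g, ⁅g, h⁆⁆ ⊔ M := by
  have hc : ⁅g, h⁆ ∈ gammaSubgroup G 2 :=
    commutatorElement_mem_gammaSubgroup_succ (n := 1) le_rfl g (mem_top h)
  have hr : ⁅g, ⁅g, h⁆⁆ ∈ gammaSubgroup G 3 :=
    commutatorElement_mem_gammaSubgroup_succ (by norm_num) g hc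
  have : (zpowers ⁅g, ⁅g, h⁆⁆ ⊔ M).Normal :=
    zpowers_sup_normal (gammaSubgroup_le_upperCentralSeriesStep (by norm_num) h4 hr)
  exact gammaSubgroup_succ_le_of_zpowers hhg (by norm_num) (gammaSubgroup_two_le_zpowers_sup hhg)
    (h4.trans le_sup_right) (mem_sup_right hM) (mem_sup_left (mem_zpowers _))

/-- Both generators of γ_3 modulo γ_4 then lie in `H'γ_4`, so γ_3 itself lies in `H'` by the
Nakayama principle. -/
theorem gammaSubgroup_four_le_commutator_of_mem [Group.IsNilpotent G] {h g : G}
    (hhg : closure {h, g} = ⊤) (hr : ⁅g, ⁅g, h⁆⁆ ∈ zpowers ⁅h, ⁅g, h⁆⁆ ⊔ gammaSubgroup G 4) :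
    gammaSubgroup G 4 ≤ ⁅zpowers h ⊔ commutator G, zpowers h ⊔ commutator G⁆ := by
  have hMn := commutator_zpowers_sup_normal h
  have hc : ⁅g, h⁆ ∈ commutator G :=
    commutatorElement_mem_gammaSubgroup_succ (n := 1) le_rfl g (mem_top h)
  have hp := commutatorElement_mem_commutator_zpowers_sup (h := h) hc
  refine (gammaSubgroup_antitone (by norm_num : 3 ≤ 4)).trans
    (gammaSubgroup_le_of_le_sup_succ (by norm_num) ?_)
  refine (gammaSubgroup_three_le_zpowers_sup hhg (mem_sup_left hp) le_sup_right).trans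
    (sup_le (zpowers_le.mpr ?_) le_rfl)
  exact sup_le_sup_right (zpowers_le.mpr hp) _ hr

theorem index_commutator_le_of_gammaSubgroup_four_le [Finite G] [Group.IsNilpotent G]
    (hab : (commutator G).index = 9) (hcard : 81 ≤ Nat.card G) {h g : G} (hhg : closure {h, g} = ⊤)
    (h4 : gammaSubgroup G 4 ≤ ⁅zpowers h ⊔ commutator G, zpowers h ⊔ commutator G⁆) :
    (commutator ↥(zpowers h ⊔ commutator G)).index ≤ 27 := by
  have hMn := commutator_zpowers_sup_normal h
  have hco := isCoatom_zpowers_sup_commutator hab hcard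
    (notMem_commutator_of_closure_pair_eq_top hab hcard hhg)
  have hc : ⁅g, h⁆ ∈ commutator G :=
    commutatorElement_mem_gammaSubgroup_succ (n := 1) le_rfl g (mem_top h)
  have hr : ⁅g, ⁅g, h⁆⁆ ∈ gammaSubgroup G 3 :=
    commutatorElement_mem_gammaSubgroup_succ (n := 2) (by norm_num) g hc
  set H := zpowers h ⊔ commutator G with hH
  have hdvd : (⁅H, H⁆ : Subgroup G).relIndex (gammaSubgroup G 3) ∣ 3 :=
    relIndex_dvd_of_le_zpowers_sup (h4 (pow_mem_gammaSubgroup_succ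
      (pow_three_mem_gammaSubgroup_two hab hcard) (by norm_num) hr))
      (gammaSubgroup_three_le_zpowers_sup hhg (commutatorElement_mem_commutator_zpowers_sup hc) h4)
  -- `H'` contains `H' ∩ γ_3`, whose index in γ_3 divides 3, while γ_3 has index 27.
  have hidx : (⁅H, H⁆ : Subgroup G).index ∣ 81 := by
    refine (index_dvd_of_le (inf_le_left : ⁅H, H⁆ ⊓ gammaSubgroup G 3 ≤ _)).trans ?_
    rw [← relIndex_mul_index (inf_le_right : ⁅H, H⁆ ⊓ gammaSubgroup G 3 ≤ _), inf_relIndex_right,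
      index_gammaSubgroup_three hab hcard]
    exact Nat.mul_dvd_mul hdvd (dvd_refl 27)
  have hHi : 3 ≤ H.index := by
    have h9 : H.index ∣ 9 := hab ▸ index_dvd_of_le (le_sup_right : commutator G ≤ H)
    have h1 : H.index ≠ 1 := fun e => hco.1 (index_eq_one.mp e)
    have hle := Nat.le_of_dvd (by norm_num) h9
    interval_cases H.index <;> omega
  have hmul := relIndex_mul_index (Subgroup.commutator_le_self H)
  have heq : (commutator H).index = (⁅H, H⁆ : Subgroup G).relIndex H := by
    rw [← map_subtype_commutator, relIndex, subgroupOf, comap_map_eq_self_of_injective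
      H.subtype_injective]
  rw [heq]
  have := Nat.le_of_dvd (by norm_num) hidx
  nlinarith

/-- Modulo γ_4 the cube `h ^ 3` is central, so cubing `g h g⁻¹ = ⁅g, h⁆ h` leaves `⁅g, h⁆ ^ 3 = 1`.
-/
theorem commutatorElement_pow_three_mem_gammaSubgroup_four [Finite G] [Group.IsNilpotent G]
    (hab : (commutator G).index = 9) (hcard : 81 ≤ Nat.card G) (g h : G) :
    ⁅g, h⁆ ^ 3 ∈ gammaSubgroup G 4 := by
  have hc : ⁅g, h⁆ ∈ gammaSubgroup G 2 :=
    commutatorElement_mem_gammaSubgroup_succ (n := 1) le_rfl g (mem_top h)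
  have hq : ⁅h, ⁅g, h⁆⁆ ∈ gammaSubgroup G 3 :=
    commutatorElement_mem_gammaSubgroup_succ (by norm_num) h hc
  have hcen : ∀ (a : G) {z : G}, z ∈ gammaSubgroup G 3 → Commute (a : G ⧸ gammaSubgroup G 4) z :=
    fun a z hz => commute_mk_iff.mpr (commutatorElement_mem_gammaSubgroup_succ (by norm_num) a hz)
  have hq3 := pow_mem_gammaSubgroup_succ (pow_three_mem_gammaSubgroup_two hab hcard)
    (by norm_num) hq
  rw [← QuotientGroup.eq_one_iff, QuotientGroup.mk_pow] at hq3
  have e := mul_pow_three_of_conj_eq (conj_mk_eq (N := gammaSubgroup G 4) h ⁅g, h⁆)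
    (hcen _ hq).symm (hcen _ hq).symm
  have hh := hcen g (pow_three_mem_gammaSubgroup_three hab hcard h)
  rw [QuotientGroup.mk_pow] at hh
  rw [hq3, one_mul, ← conj_mk_eq, ← map_pow, MulAut.conj_apply, hh.eq, mul_inv_cancel_right,
    right_eq_mul] at e
  exact (QuotientGroup.eq_one_iff (⁅g, h⁆ ^ 3)).mp e

/-- Write `h ^ 3 = r ^ i * m` with `r = ⁅g, ⁅g, h⁆⁆` and `m ∈ H'γ_4`. In `G/H'γ_5`, where `H`
becomes abelian, `t = ⁅g, r⁆` satisfies `t ^ (i + 1) = t ^ 3 = 1`. Unless `i ≡ -1` modulo 3, this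
gives `t = 1` and then γ_4 ≤ `H'`. -/
theorem pow_three_mul_mem_of_not_gammaSubgroup_four_le [Finite G] [Group.IsNilpotent G]
    (hab : (commutator G).index = 9) (hcard : 81 ≤ Nat.card G) {h g : G} (hhg : closure {h, g} = ⊤)
    (h4 : ¬ gammaSubgroup G 4 ≤ ⁅zpowers h ⊔ commutator G, zpowers h ⊔ commutator G⁆) :
    h ^ 3 * ⁅g, ⁅g, h⁆⁆ ∈
      ⁅zpowers h ⊔ commutator G, zpowers h ⊔ commutator G⁆ ⊔ gammaSubgroup G 4 := by
  have hMn := commutator_zpowers_sup_normal h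
  have hc : ⁅g, h⁆ ∈ gammaSubgroup G 2 :=
    commutatorElement_mem_gammaSubgroup_succ (n := 1) le_rfl g (mem_top h)
  have hr : ⁅g, ⁅g, h⁆⁆ ∈ gammaSubgroup G 3 :=
    commutatorElement_mem_gammaSubgroup_succ (n := 2) (by norm_num) g hc
  have ht : ⁅g, ⁅g, ⁅g, h⁆⁆⁆ ∈ gammaSubgroup G 4 :=
    commutatorElement_mem_gammaSubgroup_succ (n := 3) (by norm_num) g hr
  have hcube := pow_three_mem_gammaSubgroup_two hab hcard
  have hr3 := pow_mem_gammaSubgroup_succ hcube (by norm_num) hr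
  have hp := commutatorElement_mem_commutator_zpowers_sup (h := h) hc
  have hle := gammaSubgroup_three_le_zpowers_sup hhg
    (mem_sup_left hp : _ ∈ _ ⊔ gammaSubgroup G 4) le_sup_right
  set c := ⁅g, h⁆ with hcdef
  set r := ⁅g, c⁆ with hrdef
  set t := ⁅g, r⁆ with htdef
  set H := zpowers h ⊔ commutator G with hH
  set M : Subgroup G := ⁅H, H⁆ with hM
  by_contra hcon
  apply h4
  apply gammaSubgroup_le_of_le_sup_succ (by norm_num)
  have hrH : r ∈ H := mem_sup_right (gammaSubgroup_antitone (by norm_num : 2 ≤ 3) hr)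
  have htH : t ∈ H := mem_sup_right (gammaSubgroup_antitone (by norm_num : 2 ≤ 4) ht)
  have hcH : c ∈ H := mem_sup_right hc
  have hhH : h ∈ H := mem_sup_left (mem_zpowers h)
  have hcomm : ∀ {a b : G}, a ∈ H → b ∈ H → Commute (a : G ⧸ M ⊔ gammaSubgroup G 5) b :=
    fun ha hb => commute_mk_iff.mpr (mem_sup_left (commutator_mem_commutator ha hb))
  have hcen : ∀ (a : G) {z : G}, z ∈ gammaSubgroup G 4 →
      Commute (a : G ⧸ M ⊔ gammaSubgroup G 5) z := fun a z hz =>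
    commute_mk_iff.mpr (mem_sup_right (commutatorElement_mem_gammaSubgroup_succ (by norm_num) a hz))
  obtain ⟨_, ⟨i, rfl⟩, m, hm, hrm⟩ := mem_sup_of_normal_right.mp
    (hle (pow_three_mem_gammaSubgroup_three hab hcard h))
  simp only at hrm
  have hmcomm : Commute (g : G ⧸ M ⊔ gammaSubgroup G 5) m := by
    rw [commute_mk_iff]
    have hle' : M ⊔ gammaSubgroup G 4 ≤ (M ⊔ gammaSubgroup G 5).upperCentralSeriesStep :=
      sup_le (le_upperCentralSeriesStep_of_le le_sup_left)
        (gammaSubgroup_le_upperCentralSeriesStep (by norm_num) le_sup_right)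
    exact mem_upperCentralSeriesStep_iff.mp (hle' hm) g
  obtain ⟨ht1, ht3⟩ := zpow_eq_one_of_conj_relations (conj_mk_eq g h) (conj_mk_eq g c)
    (conj_mk_eq g r) (hcomm hcH hhH) (hcomm hrH hcH) (hcomm htH hrH)
    (hcomm (mem_sup_right (hcube g)) hhH)
    (hcen g (commutatorElement_pow_three_mem_gammaSubgroup_four hab hcard g h)) hmcomm
    (by rw [← QuotientGroup.mk_pow, ← hrm]; rfl)
  have htN : t ∈ M ⊔ gammaSubgroup G 5 := by
    rw [← QuotientGroup.eq_one_iff]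
    obtain ⟨k, hk | hk | hk⟩ : ∃ k : ℤ, i + 1 = 3 * k ∨ i + 1 = 3 * k + 1 ∨ i + 1 = 3 * k + 2 :=
      ⟨(i + 1) / 3, by omega⟩
    -- If 3 divides `i + 1`, then `h ^ 3 * r` is a power of `r ^ 3 ∈ γ_4` times a conjugate of `m`,
    -- contrary to `hcon`.
    · refine absurd ?_ hcon
      have hk' : r ^ i * m * r = (r ^ 3) ^ k * (r⁻¹ * m * r⁻¹⁻¹) := by
        rw [← zpow_natCast, ← zpow_mul, Nat.cast_ofNat, ← hk, zpow_add_one]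
        group
      rw [← hrm, hk']
      exact mul_mem (mem_sup_right (zpow_mem hr3 k)) (Normal.conj_mem inferInstance m hm r⁻¹)
    · rwa [hk, zpow_add_one, zpow_mul, zpow_ofNat, ht3, one_zpow, one_mul] at ht1
    · rw [hk, zpow_add, zpow_mul, zpow_ofNat, ht3, one_zpow, one_mul, zpow_ofNat] at ht1
      rwa [pow_succ, ht1, one_mul] at ht3
  refine gammaSubgroup_succ_le_of_le_upperCentralSeriesStep (n := 3) (by norm_num)
    (hle.trans (sup_le (zpowers_le.mpr ?_) (sup_le ?_ ?_)))
  · refine mem_upperCentralSeriesStep_of_closure_eq_top hhg ?_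
    rintro _ (rfl | rfl)
    · exact mem_sup_left (commutator_mem_commutator hhH hrH)
    · exact htN
  · exact le_upperCentralSeriesStep_of_le le_sup_left
  · exact gammaSubgroup_le_upperCentralSeriesStep (by norm_num) le_sup_right

end MaximalSubgroups

/-! ### The four cube conditions in a quotient of class three. -/

section ClassThree

variable {Q : Type*} [Group Q]

theorem commutatorElement_inv_right_of_central {a c : Q} (h : ∀ z, Commute ⁅a, c⁆ z) :
    ⁅a, c⁻¹⁆ = ⁅a, c⁆⁻¹ := by
  rw [commutatorElement_inv_right, ← commutatorElement_inv, (h c⁻¹).inv_left.symm.eq,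
    inv_mul_cancel_right]

theorem commutatorElement_inv_left_of_central {a c : Q} (h : ∀ z, Commute ⁅a, c⁆ z) :
    ⁅a⁻¹, c⁆ = ⁅a, c⁆⁻¹ := by
  rw [commutatorElement_inv_left, ← commutatorElement_inv, (h a⁻¹).inv_left.symm.eq,
    inv_mul_cancel_right]

theorem commutatorElement_mul_left_of_central {a b c : Q} (h : ∀ z, Commute ⁅b, c⁆ z) :
    ⁅a * b, c⁆ = ⁅b, c⁆ * ⁅a, c⁆ := by
  rw [commutatorElement_mul_left_eq_conj_mul, (h a).symm.eq, mul_inv_cancel_right]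

theorem commutatorElement_mul_right_of_central {a z c : Q} (h : ∀ w, Commute z w) :
    ⁅a, z * c⁆ = ⁅a, c⁆ := by
  rw [commutatorElement_mul_right_eq_mul_conj, (h a).symm.commutator_eq, one_mul, (h _).eq,
    mul_inv_cancel_right]

theorem commutatorElement_self_mul (x y : Q) : ⁅y, y * x⁆ = ⁅y, ⁅y, x⁆⁆ * ⁅y, x⁆ := by
  simp [commutatorElement_def, mul_assoc]

theorem commutatorElement_self_inv_mul (x y : Q) : ⁅y, y⁻¹ * x⁆ = ⁅y⁻¹, ⁅y, x⁆⁆ * ⁅y, x⁆ := by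
  simp [commutatorElement_def, mul_assoc]

open scoped IsMulCommutative in
-- With `p = ⁅x, ⁅y, x⁆⁆` and `q = ⁅y, ⁅y, x⁆⁆`, the elements `p`, `q`, `x ^ 3`, `y ^ 3` are
-- central. The formulas for `(yx)^3` and `(y⁻¹x)^3` make the four hypotheses linear equations among
-- them, solved by `exists_eq_zsmul_add_or_sub` in the additive centre.
theorem exists_zpow_eq_of_class_three (hcen : ∀ a b d z : Q, Commute ⁅a, ⁅b, d⁆⁆ z)
    (hexp : ∀ a b : Q, ⁅a, b⁆ ^ 3 = 1) (hcube : ∀ a z : Q, Commute (a ^ 3) z) (x y : Q)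
    (hx : ∃ k : ℤ, ⁅x, ⁅y, x⁆⁆ ^ k = x ^ 3 * ⁅y, ⁅y, x⁆⁆)
    (hy : ∃ k : ℤ, ⁅y, ⁅x, y⁆⁆ ^ k = y ^ 3 * ⁅x, ⁅x, y⁆⁆)
    (hyx : ∃ k : ℤ, ⁅y * x, ⁅y, y * x⁆⁆ ^ k = (y * x) ^ 3 * ⁅y, ⁅y, y * x⁆⁆)
    (hyx' : ∃ k : ℤ, ⁅y⁻¹ * x, ⁅y, y⁻¹ * x⁆⁆ ^ k = (y⁻¹ * x) ^ 3 * ⁅y, ⁅y, y⁻¹ * x⁆⁆) :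
    (∃ k : ℤ, ⁅y * x, ⁅y, y * x⁆⁆ ^ k = ⁅y, ⁅y, y * x⁆⁆) ∨
      ∃ k : ℤ, ⁅y⁻¹ * x, ⁅y, y⁻¹ * x⁆⁆ ^ k = ⁅y, ⁅y, y⁻¹ * x⁆⁆ := by
  have e0 : ⁅x, y⁆ = ⁅y, x⁆⁻¹ := (commutatorElement_inv y x).symm
  have hp := hcen x y x
  have hq := hcen y y x
  have hqi : ∀ z, Commute ⁅y⁻¹, ⁅y, x⁆⁆ z := hcen y⁻¹ y x
  have eqi : ⁅y⁻¹, ⁅y, x⁆⁆ = ⁅y, ⁅y, x⁆⁆⁻¹ := commutatorElement_inv_left_of_central hq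
  have e1 : ⁅y, ⁅y, y * x⁆⁆ = ⁅y, ⁅y, x⁆⁆ := by
    rw [commutatorElement_self_mul, commutatorElement_mul_right_of_central hq]
  have e2 : ⁅y * x, ⁅y, y * x⁆⁆ = ⁅x, ⁅y, x⁆⁆ * ⁅y, ⁅y, x⁆⁆ := by
    rw [commutatorElement_self_mul, commutatorElement_mul_right_of_central hq,
      commutatorElement_mul_left_of_central hp]
  have e3 : ⁅y, ⁅y, y⁻¹ * x⁆⁆ = ⁅y, ⁅y, x⁆⁆ := by
    rw [commutatorElement_self_inv_mul, commutatorElement_mul_right_of_central hqi]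
  have e4 : ⁅y⁻¹ * x, ⁅y, y⁻¹ * x⁆⁆ = ⁅x, ⁅y, x⁆⁆ * ⁅y, ⁅y, x⁆⁆⁻¹ := by
    rw [commutatorElement_self_inv_mul, commutatorElement_mul_right_of_central hqi,
      commutatorElement_mul_left_of_central hp, eqi]
  rw [e0, commutatorElement_inv_right_of_central hp, commutatorElement_inv_right_of_central hq]
    at hy
  rw [e1, e2] at hyx ⊢
  rw [e3, e4] at hyx' ⊢
  have hc3 := hexp y x
  have hp3 := hexp x ⁅y, x⁆
  have hq3 := hexp y ⁅y, x⁆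
  have hmul : ∀ a b : Q, a * b = ⁅a, b⁆ * b * a := fun a b => by
    simp [commutatorElement_def]
  have f1 := mul_pow_three_of_conj_relations (hmul y x) (hmul x ⁅y, x⁆) (hmul y ⁅y, x⁆)
    hp hq hc3 hp3 hq3
  have g1 : ⁅y⁻¹, x⁆ = ⁅y, ⁅y, x⁆⁆ * ⁅y, x⁆⁻¹ := by
    rw [commutatorElement_inv_left, ← commutatorElement_inv y x]
    have := hmul y⁻¹ ⁅y, x⁆⁻¹
    rw [commutatorElement_inv_right_of_central hqi, eqi, inv_inv] at this
    rw [this, inv_mul_cancel_right]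
  have g2 : ⁅x, ⁅y⁻¹, x⁆⁆ = ⁅x, ⁅y, x⁆⁆⁻¹ := by
    rw [g1, commutatorElement_mul_right_of_central hq, commutatorElement_inv_right_of_central hp]
  have g3 : ⁅y⁻¹, ⁅y⁻¹, x⁆⁆ = ⁅y, ⁅y, x⁆⁆ := by
    rw [g1, commutatorElement_mul_right_of_central hq, commutatorElement_inv_right_of_central hqi,
      eqi, inv_inv]
  have f2 := mul_pow_three_of_conj_relations (hmul y⁻¹ x) (hmul x ⁅y⁻¹, x⁆) (hmul y⁻¹ ⁅y⁻¹, x⁆)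
    (hcen _ _ _) (hcen _ _ _) (hexp _ _) (hexp _ _) (hexp _ _)
  rw [g2, g3, inv_inv] at f2
  rw [f1] at hyx
  rw [f2] at hyx'
  generalize ⁅x, ⁅y, x⁆⁆ = p at *
  generalize ⁅y, ⁅y, x⁆⁆ = q at *
  obtain ⟨a, ha⟩ := hx
  obtain ⟨b, hb⟩ := hy
  obtain ⟨e, he⟩ := hyx
  obtain ⟨f, hf⟩ := hyx'
  let mk (z : Q) (hz : ∀ w, Commute z w) : Additive (center Q) :=
    Additive.ofMul ⟨z, mem_center_iff.mpr fun w => ((hz w).eq).symm⟩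
  have inj : ∀ {u v : Additive (center Q)},
      ((Additive.toMul u : center Q) : Q) = (Additive.toMul v : center Q) →
      u = v := fun h => Additive.toMul.injective (Subtype.ext h)
  -- The sign of `b` changes because exchanging `x` and `y` inverts the basic commutator, so `hy`
  -- involves powers of `q⁻¹`.
  have key := exists_eq_zsmul_add_or_sub (p := mk p hp) (q := mk q hq)
    (X := mk (x ^ 3) (hcube x)) (Y := mk (y ^ 3) (hcube y)) (a := a) (b := -b) (e := e) (f := f)
    (inj ?_) (inj ?_) (inj ?_) (inj ?_) (inj ?_) (inj ?_)
  · refine key.imp ?_ ?_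
    · rintro ⟨k, hk⟩
      exact ⟨k, congrArg (fun u : Additive (center Q) => ((Additive.toMul u : center Q) : Q)) hk⟩
    · rintro ⟨k, hk⟩
      refine ⟨k, ?_⟩
      rw [← div_eq_mul_inv]
      exact congrArg (fun u : Additive (center Q) => ((Additive.toMul u : center Q) : Q)) hk
  · change p ^ (3 : ℤ) = 1
    exact_mod_cast hp3
  · change q ^ (3 : ℤ) = 1
    exact_mod_cast hq3
  · exact ha.symm
  · change y ^ 3 / p = q ^ (-b)
    rw [div_eq_mul_inv, ← hb, inv_zpow, zpow_neg]
  · exact he.symm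
  · change p * q * x ^ 3 / y ^ 3 * q = (p / q) ^ f
    rw [div_eq_mul_inv, div_eq_mul_inv, hf, inv_pow]

end ClassThree

/-! ### A maximal subgroup `H` with `|H:H'| ≤ 27`. -/

section SmallIndex

variable {G : Type*} [Group G]

theorem mem_zpowers_sup_iff {N : Subgroup G} [N.Normal] {p z : G} :
    z ∈ zpowers p ⊔ N ↔ ∃ k : ℤ, (p : G ⧸ N) ^ k = z := by
  have h : zpowers p ⊔ N = (zpowers (p : G ⧸ N)).comap (QuotientGroup.mk' N) := by
    have := comap_map_eq (QuotientGroup.mk' N) (zpowers p)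
    rw [QuotientGroup.ker_mk', MonoidHom.map_zpowers] at this
    exact this.symm
  rw [h]
  exact mem_zpowers_iff

theorem exists_isCoatom_index_commutator_le [Finite G] [Group.IsNilpotent G]
    (hab : (commutator G).index = 9) (hcard : 81 ≤ Nat.card G) :
    ∃ H : Subgroup G, IsCoatom H ∧ (commutator H).index ≤ 27 := by
  by_contra hcon
  have h4 : ∀ {h g : G}, closure {h, g} = ⊤ →
      ¬ gammaSubgroup G 4 ≤ ⁅zpowers h ⊔ commutator G, zpowers h ⊔ commutator G⁆ :=
    fun {h g} hhg hle => hcon ⟨_, isCoatom_zpowers_sup_commutator hab hcard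
      (notMem_commutator_of_closure_pair_eq_top hab hcard hhg),
      index_commutator_le_of_gammaSubgroup_four_le hab hcard hhg hle⟩
  have hbad : ∀ {h g : G}, closure {h, g} = ⊤ → ∃ k : ℤ,
      ⁅(h : G ⧸ gammaSubgroup G 4), ⁅(g : G ⧸ gammaSubgroup G 4), (h : G ⧸ gammaSubgroup G 4)⁆⁆ ^ k =
        (h : G ⧸ gammaSubgroup G 4) ^ 3 * ⁅(g : G ⧸ gammaSubgroup G 4), ⁅(g : G ⧸ gammaSubgroup G 4),
          (h : G ⧸ gammaSubgroup G 4)⁆⁆ := fun {h g} hhg =>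
    mem_zpowers_sup_iff.mp (sup_le (commutator_zpowers_sup_le hhg) le_sup_right
      (pow_three_mul_mem_of_not_gammaSubgroup_four_le hab hcard hhg (h4 hhg)))
  have hnot : ∀ {h g : G}, closure {h, g} = ⊤ → ¬ ∃ k : ℤ,
      ⁅(h : G ⧸ gammaSubgroup G 4), ⁅(g : G ⧸ gammaSubgroup G 4), (h : G ⧸ gammaSubgroup G 4)⁆⁆ ^ k =
        ⁅(g : G ⧸ gammaSubgroup G 4), ⁅(g : G ⧸ gammaSubgroup G 4),
          (h : G ⧸ gammaSubgroup G 4)⁆⁆ := fun {h g} hhg hk =>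
    h4 hhg (gammaSubgroup_four_le_commutator_of_mem hhg (mem_zpowers_sup_iff.mpr hk))
  have hcen : ∀ (a : G) {z : G}, z ∈ gammaSubgroup G 3 → Commute (z : G ⧸ gammaSubgroup G 4) a :=
    fun a z hz =>
      (commute_mk_iff.mpr (commutatorElement_mem_gammaSubgroup_succ (by norm_num) a hz)).symm
  obtain ⟨x, y, hxy⟩ := exists_closure_pair_eq_top hab hcard
  have hgen : ∀ {a b : G}, x ∈ closure {a, b} → y ∈ closure {a, b} → closure {a, b} = ⊤ := by
    intro a b ha hb
    rw [eq_top_iff, ← hxy, closure_le, Set.insert_subset_iff, Set.singleton_subset_iff]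
    exact ⟨ha, hb⟩
  have hyx : closure {y, x} = ⊤ := by rwa [Set.pair_comm]
  have h1 : closure {y * x, y} = ⊤ := by
    have hy : y ∈ closure {y * x, y} := subset_closure (by simp)
    refine hgen ?_ hy
    have : y⁻¹ * (y * x) ∈ closure {y * x, y} := mul_mem (inv_mem hy) (subset_closure (by simp))
    rwa [inv_mul_cancel_left] at this
  have h2 : closure {y⁻¹ * x, y} = ⊤ := by
    have hy : y ∈ closure {y⁻¹ * x, y} := subset_closure (by simp)
    refine hgen ?_ hy
    have : y * (y⁻¹ * x) ∈ closure {y⁻¹ * x, y} := mul_mem hy (subset_closure (by simp))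
    rwa [mul_inv_cancel_left] at this
  have key := exists_zpow_eq_of_class_three (Q := G ⧸ gammaSubgroup G 4) ?_ ?_ ?_ x y (hbad hxy)
    (hbad hyx) (hbad h1) (hbad h2)
  · exact key.elim (hnot h1) (hnot h2)
  · intro a b d z
    induction a using QuotientGroup.induction_on
    induction b using QuotientGroup.induction_on
    induction d using QuotientGroup.induction_on
    induction z using QuotientGroup.induction_on
    exact hcen _ (commutatorElement_mem_gammaSubgroup_succ (n := 2) (by norm_num) _
      (commutatorElement_mem_gammaSubgroup_succ (n := 1) le_rfl _ (mem_top _)))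
  · intro a b
    induction a using QuotientGroup.induction_on
    induction b using QuotientGroup.induction_on
    exact (QuotientGroup.eq_one_iff _).mpr
      (commutatorElement_pow_three_mem_gammaSubgroup_four hab hcard _ _)
  · intro a z
    induction a using QuotientGroup.induction_on
    induction z using QuotientGroup.induction_on
    exact hcen _ (pow_three_mem_gammaSubgroup_three hab hcard _)

end SmallIndex

/-! ### Maximal class from `|G:γ_4| = 81`. -/

section MaximalClass

variable {G : Type*} [Group G]

theorem commutatorElement_mem_of_gammaSubgroup_le {n : ℕ} (hn : 1 ≤ n) {a d : G}
    (hd : gammaSubgroup G n ≤ zpowers d ⊔ gammaSubgroup G (n + 1)) {N : Subgroup G} [N.Normal]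
    (hN : gammaSubgroup G (n + 2) ≤ N) (had : ⁅a, d⁆ ∈ N) {z : G} (hz : z ∈ gammaSubgroup G n) :
    ⁅a, z⁆ ∈ N := by
  have hle : zpowers d ⊔ gammaSubgroup G (n + 1) ≤
      (centralizer {(a : G ⧸ N)}).comap (QuotientGroup.mk' N) := by
    refine sup_le ?_ fun w hw => ?_
    · rw [zpowers_le, mem_comap, mem_centralizer_singleton_iff]
      exact (commute_mk_iff.mpr had).symm.eq
    · rw [mem_comap, mem_centralizer_singleton_iff]
      exact (commute_mk_iff.mpr
        (hN (commutatorElement_mem_gammaSubgroup_succ (by omega) a hw))).symm.eq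
  have := hle (hd hz)
  rw [mem_comap, mem_centralizer_singleton_iff] at this
  exact commute_mk_iff.mp (show Commute (a : G ⧸ N) z from this.symm)

/-- Conjugating `a` three times by `s` is conjugation by `s ^ 3`, trivial modulo γ_{n+4} for reasons
of weight; the product is the binomial expansion of this triviality. -/
theorem mul_pow_three_mem_of_pow_three_mem {s a : G} {n : ℕ} (hn : 1 ≤ n)
    (hs : s ^ 3 ∈ gammaSubgroup G 4) (ha : a ∈ gammaSubgroup G n) :
    ⁅s, ⁅s, ⁅s, a⁆⁆⁆ * ⁅s, ⁅s, a⁆⁆ ^ 3 * ⁅s, a⁆ ^ 3 ∈ gammaSubgroup G (n + 4) := by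
  have hb := commutatorElement_mem_gammaSubgroup_succ hn s ha
  have he := commutatorElement_mem_gammaSubgroup_succ (by omega) s hb
  have h1 := conj_mk_eq (N := gammaSubgroup G (n + 4)) s a
  have h2 := conj_mk_eq (N := gammaSubgroup G (n + 4)) s ⁅s, a⁆
  have h3 := conj_mk_eq (N := gammaSubgroup G (n + 4)) s ⁅s, ⁅s, a⁆⁆
  have hcomm : Commute ((⁅s, a⁆ : G) : G ⧸ gammaSubgroup G (n + 4)) (⁅s, ⁅s, a⁆⁆ : G) :=
    commute_mk_iff.mpr (commutatorElement_mem_gammaSubgroup (by omega) (by omega) hb he (by omega))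
  have hsa : Commute ((s : G ⧸ gammaSubgroup G (n + 4)) ^ 3) a := by
    rw [← QuotientGroup.mk_pow]
    exact commute_mk_iff.mpr
      (commutatorElement_mem_gammaSubgroup (by omega) hn hs ha (by omega))
  rw [← QuotientGroup.eq_one_iff, QuotientGroup.mk_mul, QuotientGroup.mk_mul, QuotientGroup.mk_pow,
    QuotientGroup.mk_pow]
  generalize ((⁅s, ⁅s, ⁅s, a⁆⁆⁆ : G) : G ⧸ gammaSubgroup G (n + 4)) = f at *
  generalize ((⁅s, ⁅s, a⁆⁆ : G) : G ⧸ gammaSubgroup G (n + 4)) = e at *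
  generalize ((⁅s, a⁆ : G) : G ⧸ gammaSubgroup G (n + 4)) = b at *
  generalize (s : G ⧸ gammaSubgroup G (n + 4)) = s at *
  generalize (a : G ⧸ gammaSubgroup G (n + 4)) = a at *
  have e1 : MulAut.conj s (MulAut.conj s (MulAut.conj s a)) = f * e ^ 3 * b ^ 3 * a := by
    simp only [h1, h2, h3, map_mul]
    have : ∀ z, b * (e * z) = e * (b * z) := fun z => hcomm.left_comm z
    simp only [pow_succ, pow_zero, one_mul, mul_assoc, this]
  have e2 : MulAut.conj s (MulAut.conj s (MulAut.conj s a)) = a := by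
    have : MulAut.conj s (MulAut.conj s (MulAut.conj s a)) = s ^ 3 * a * (s ^ 3)⁻¹ := by
      simp only [MulAut.conj_apply, pow_succ, pow_zero, one_mul, mul_inv_rev, mul_assoc]
    rw [this, hsa.eq, mul_inv_cancel_right]
  rw [e2] at e1
  exact right_eq_mul.mp e1

/-- The preceding relation applied to `⁅s, a⁆`, one weight deeper, puts `⁅s, ⁅s, a⁆⁆ ^ 3` in
γ_{n+4}, so the middle factor drops out. -/
theorem commutatorElement_mul_pow_three_mem {s a : G} {n : ℕ} (hn : 1 ≤ n)
    (hcube : ∀ g : G, g ^ 3 ∈ gammaSubgroup G 2) (hs : s ^ 3 ∈ gammaSubgroup G 4)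
    (ha : a ∈ gammaSubgroup G n) :
    ⁅s, ⁅s, ⁅s, a⁆⁆⁆ * ⁅s, a⁆ ^ 3 ∈ gammaSubgroup G (n + 4) := by
  have hb := commutatorElement_mem_gammaSubgroup_succ hn s ha
  have he := commutatorElement_mem_gammaSubgroup_succ (by omega) s hb
  have hf := commutatorElement_mem_gammaSubgroup_succ (by omega) s he
  have hf' := commutatorElement_mem_gammaSubgroup_succ (by omega) s hf
  have hf3 := pow_mem_gammaSubgroup_succ hcube (by omega) hf
  have h1 := mul_pow_three_mem_of_pow_three_mem hn hs ha
  have h2 := gammaSubgroup_antitone (by omega : n + 4 ≤ n + 1 + 4)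
    (mul_pow_three_mem_of_pow_three_mem (by omega) hs hb)
  rw [mul_mem_cancel_left (mul_mem hf' hf3)] at h2
  rw [← QuotientGroup.eq_one_iff] at h1 h2 ⊢
  rw [QuotientGroup.mk_mul, QuotientGroup.mk_mul, h2, mul_one] at h1
  exact h1

theorem relIndex_gammaSubgroup_dvd_three {s s₁ : G} (hgen : closure {s₁, s} = ⊤)
    (hcube : ∀ g : G, g ^ 3 ∈ gammaSubgroup G 2) (hs : s ^ 3 ∈ gammaSubgroup G 4)
    (h2 : ∀ z ∈ gammaSubgroup G 2, ⁅s₁, z⁆ ∈ gammaSubgroup G 4)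
    (h3 : ∀ z ∈ gammaSubgroup G 3, ⁅s₁, z⁆ ∈ gammaSubgroup G 5) {n : ℕ} (hn : 2 ≤ n) :
    (gammaSubgroup G (n + 1)).relIndex (gammaSubgroup G n) ∣ 3 := by
  -- `D k` is the commutator with `k` entries `s` ending in `s₁`, of weight `k + 1`.
  let D : ℕ → G := fun k => (fun z => ⁅s, z⁆)^[k] s₁
  have hD : ∀ k, D (k + 1) = ⁅s, D k⁆ := fun k => Function.iterate_succ_apply' _ _ _
  have hDmem : ∀ k, D k ∈ gammaSubgroup G (k + 1) := by
    intro k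
    induction k with
    | zero => exact mem_top _
    | succ k ih => rw [hD]; exact commutatorElement_mem_gammaSubgroup_succ (by omega) s ih
  have hstep : ∀ k, gammaSubgroup G (k + 1) ≤ zpowers (D k) ⊔ gammaSubgroup G (k + 2) →
      (∀ z ∈ gammaSubgroup G (k + 1), ⁅s₁, z⁆ ∈ gammaSubgroup G (k + 3)) →
      gammaSubgroup G (k + 2) ≤ zpowers (D (k + 1)) ⊔ gammaSubgroup G (k + 3) := by
    intro k hA hB
    have := zpowers_sup_gammaSubgroup_normal (n := k + 2) (by omega) (hDmem (k + 1))
    refine gammaSubgroup_succ_le_of_zpowers hgen (by omega) hA le_sup_right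
      (mem_sup_right (hB _ (hDmem k))) (mem_sup_left ?_)
    rw [hD]
    exact mem_zpowers _
  -- Cubing raises the weight by two, because `D (k + 1) ^ 3` is inverse to `D (k + 3)` modulo
  -- γ_{k+5}.
  have hpow : ∀ k, gammaSubgroup G (k + 2) ≤ zpowers (D (k + 1)) ⊔ gammaSubgroup G (k + 3) →
      ∀ z ∈ gammaSubgroup G (k + 2), z ^ 3 ∈ gammaSubgroup G (k + 4) := by
    intro k hA z hz
    obtain ⟨_, ⟨i, rfl⟩, w, hw, rfl⟩ := mem_sup_of_normal_right.mp (hA hz)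
    have hw3 := pow_mem_gammaSubgroup_succ hcube (by omega) hw
    have hD3 : D (k + 1) ^ 3 ∈ gammaSubgroup G (k + 4) := by
      have := gammaSubgroup_antitone (by omega : k + 4 ≤ k + 1 + 4)
        (commutatorElement_mul_pow_three_mem (by omega) hcube hs (hDmem k))
      simp only [← hD] at this
      exact (mul_mem_cancel_left (hDmem (k + 3))).mp this
    have hcomm : Commute (((D (k + 1)) ^ i : G) : G ⧸ gammaSubgroup G (k + 4)) w :=
      commute_mk_iff.mpr (commutatorElement_mem_gammaSubgroup (by omega) (by omega)
        (zpow_mem (hDmem (k + 1)) i) hw (by omega))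
    rw [← QuotientGroup.eq_one_iff] at hw3 ⊢
    rw [QuotientGroup.mk_pow] at hw3 ⊢
    simp only [QuotientGroup.mk_mul]
    rw [hcomm.mul_pow, hw3, mul_one, ← QuotientGroup.mk_pow, QuotientGroup.eq_one_iff,
      ← zpow_natCast, ← zpow_mul, mul_comm, zpow_mul, zpow_natCast]
    exact zpow_mem hD3 i
  -- Two consecutive centralizing statements are carried because the one for γ_{k+4} comes from the
  -- one for γ_{k+2}: modulo terms that `s₁` centralizes, `D (k + 3)` is `D (k + 1) ^ (-3)`, and
  -- `⁅s₁, D (k + 1)⁆ ^ 3` vanishes modulo γ_{k+6}.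
  have main : ∀ k, gammaSubgroup G (k + 2) ≤ zpowers (D (k + 1)) ⊔ gammaSubgroup G (k + 3) ∧
      (∀ z ∈ gammaSubgroup G (k + 2), ⁅s₁, z⁆ ∈ gammaSubgroup G (k + 4)) ∧
      (∀ z ∈ gammaSubgroup G (k + 3), ⁅s₁, z⁆ ∈ gammaSubgroup G (k + 5)) := by
    intro k
    induction k with
    | zero => exact ⟨gammaSubgroup_two_le_zpowers_sup hgen, h2, h3⟩
    | succ k ih =>
      obtain ⟨hA, hB, hB'⟩ := ih
      have hA' := hstep (k + 1) hA hB
      have hA'' := hstep (k + 2) hA' hB'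
      refine ⟨hA', hB', fun z hz => ?_⟩
      refine commutatorElement_mem_of_gammaSubgroup_le (by omega) hA'' le_rfl ?_ hz
      have hrel : D (k + 3) * D (k + 1) ^ 3 ∈ gammaSubgroup G (k + 5) := by
        have := commutatorElement_mul_pow_three_mem (by omega) hcube hs (hDmem k)
        simp only [← hD] at this
        exact this
      have hu := hB _ (hDmem (k + 1))
      have hu3 := hpow (k + 2) hA'' _ hu
      have hcomm : Commute ((⁅s₁, D (k + 1)⁆ : G) : G ⧸ gammaSubgroup G (k + 6)) (D (k + 1) : G) :=
        commute_mk_iff.mpr (commutatorElement_mem_gammaSubgroup (by omega) (by omega) hu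
          (hDmem (k + 1)) (by omega))
      have hfix : Commute (s₁ : G ⧸ gammaSubgroup G (k + 6)) ((D (k + 1) ^ 3 : G)) := by
        have h := congrArg (· ^ 3) (conj_mk_eq (N := gammaSubgroup G (k + 6)) s₁ (D (k + 1)))
        rw [← QuotientGroup.eq_one_iff, QuotientGroup.mk_pow] at hu3
        beta_reduce at h
        rw [← map_pow, hcomm.mul_pow, hu3, one_mul] at h
        exact mul_inv_eq_iff_eq_mul.mp h
      have hrel' : Commute (s₁ : G ⧸ gammaSubgroup G (k + 6)) (D (k + 3) * D (k + 1) ^ 3 : G) :=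
        commute_mk_iff.mpr (commutatorElement_mem_gammaSubgroup_succ (by omega) s₁ hrel)
      have := hrel'.mul_right hfix.inv_right
      rw [QuotientGroup.mk_mul, mul_inv_cancel_right] at this
      exact commute_mk_iff.mp this
  obtain ⟨k, rfl⟩ := Nat.exists_eq_add_of_le' hn
  exact relIndex_dvd_of_le_zpowers_sup
    (pow_mem_gammaSubgroup_succ hcube (by omega) (hDmem (k + 1))) (main k).1

/-- Consecutive terms coincide only when trivial, so each factor below γ_2 has order exactly 3 until
the series ends, and the order is read off from the class. -/
theorem isOfMaximalClass_of_relIndex_dvd [Finite G] [Group.IsNilpotent G]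
    (hab : (commutator G).index = 9) (hcard : 81 ≤ Nat.card G)
    (h : ∀ n, 2 ≤ n → (gammaSubgroup G (n + 1)).relIndex (gammaSubgroup G n) ∣ 3) :
    IsOfMaximalClass 3 G := by
  set c := Group.nilpotencyClass G with hc
  have hbot : ∀ n, gammaSubgroup G (n + 1) = ⊥ ↔ c ≤ n := fun n =>
    Subgroup.lowerCentralSeries_eq_bot_iff_nilpotencyClass_le
  have hidx : ∀ n, n + 2 ≤ c + 1 → (gammaSubgroup G (n + 2)).index = 3 ^ (n + 2) := by
    intro n
    induction n with
    | zero => exact fun _ => hab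
    | succ n ih =>
      intro hn
      have hmul := relIndex_mul_index (gammaSubgroup_antitone (G := G) (by omega : n + 2 ≤ n + 3))
      rw [ih (by omega)] at hmul
      rcases (Nat.dvd_prime Nat.prime_three).mp (h (n + 2) (by omega)) with h1 | h1
      · have := (hbot (n + 1)).mp
          (gammaSubgroup_eq_bot_of_le_succ (by omega) (relIndex_eq_one.mp h1))
        omega
      · rw [h1] at hmul
        rw [← hmul, pow_succ 3 (n + 2), mul_comm]
  have hc1 : 1 ≤ c := by
    by_contra hc0
    have h1 := (hbot 0).mpr (by omega)
    rw [gammaSubgroup_one] at h1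
    have h2 : commutator G = ⊤ := top_le_iff.mp (h1.le.trans bot_le)
    rw [h2, index_top] at hab
    omega
  obtain ⟨m, hm⟩ := Nat.exists_eq_add_of_le' hc1
  have hcardG : Nat.card G = 3 ^ (c + 1) := by
    have h1 := hidx m (by omega)
    rw [(hbot (m + 1)).mpr (by omega), index_bot] at h1
    rw [h1, hm]
  refine ⟨c + 1, ?_, hcardG, inferInstance, rfl⟩
  by_contra hlt
  have : 3 ^ (c + 1) ≤ 3 ^ 2 := Nat.pow_le_pow_right (by norm_num) (by omega)
  omega

/-- An element centralizing the second lower central factor modulo the fourth term also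
centralizes the third one modulo the fifth term. -/
theorem commutatorElement_mem_gammaSubgroup_five {s s₁ : G} (hgen : closure {s₁, s} = ⊤)
    (h2 : ∀ z ∈ gammaSubgroup G 2, ⁅s₁, z⁆ ∈ gammaSubgroup G 4) {z : G}
    (hz : z ∈ gammaSubgroup G 3) : ⁅s₁, z⁆ ∈ gammaSubgroup G 5 := by
  have hc : ⁅s, s₁⁆ ∈ gammaSubgroup G 2 :=
    commutatorElement_mem_gammaSubgroup_succ (n := 1) le_rfl s (mem_top _)
  have hd : ⁅s, ⁅s, s₁⁆⁆ ∈ gammaSubgroup G 3 :=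
    commutatorElement_mem_gammaSubgroup_succ (by norm_num) s hc
  have hle := gammaSubgroup_three_le_zpowers_sup hgen (h2 _ hc) le_rfl
  refine commutatorElement_mem_of_gammaSubgroup_le (by norm_num) hle le_rfl ?_ hz
  have hw := h2 _ hc
  rw [← commute_mk_iff]
  have hcd : Commute ((⁅s, s₁⁆ : G) : G ⧸ gammaSubgroup G 5) (⁅s, ⁅s, s₁⁆⁆ : G) :=
    commute_mk_iff.mpr
      (commutatorElement_mem_gammaSubgroup (by norm_num) (by norm_num) hc hd le_rfl)
  have hwc : ∀ a : G, Commute ((⁅s₁, ⁅s, s₁⁆⁆ : G) : G ⧸ gammaSubgroup G 5) a := fun a =>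
    (commute_mk_iff.mpr (commutatorElement_mem_gammaSubgroup_succ (by norm_num) a hw)).symm
  have e1 := conj_mk_eq (N := gammaSubgroup G 5) s₁ ⁅s, s₁⁆
  have e2 : MulAut.conj (s₁ : G ⧸ gammaSubgroup G 5) s =
      ((⁅s, s₁⁆ : G) : G ⧸ gammaSubgroup G 5)⁻¹ * s := by
    rw [conj_mk_eq, ← commutatorElement_inv s s₁]
    rfl
  have e3 : ((⁅s, ⁅s, s₁⁆⁆ : G) : G ⧸ gammaSubgroup G 5) =
      s * (⁅s, s₁⁆ : G) * (s : G ⧸ gammaSubgroup G 5)⁻¹ *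
        ((⁅s, s₁⁆ : G) : G ⧸ gammaSubgroup G 5)⁻¹ := rfl
  have hws := hwc s
  have hwc := hwc ⁅s, s₁⁆
  refine mul_inv_eq_iff_eq_mul.mp ?_
  rw [← MulAut.conj_apply]
  generalize ((⁅s₁, ⁅s, s₁⁆⁆ : G) : G ⧸ gammaSubgroup G 5) = w at *
  generalize ((⁅s, ⁅s, s₁⁆⁆ : G) : G ⧸ gammaSubgroup G 5) = d at *
  generalize ((⁅s, s₁⁆ : G) : G ⧸ gammaSubgroup G 5) = c at *
  generalize (s : G ⧸ gammaSubgroup G 5) = s at *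
  generalize (s₁ : G ⧸ gammaSubgroup G 5) = s₁ at *
  -- Conjugation by `s₁` sends `s` to `c⁻¹s` and `c` to `wc` with `w` central, so `d = ⁅s, c⁆` goes
  -- to `c⁻¹dc`, which is `d` because [γ_2, γ_3] ≤ γ_5.
  calc MulAut.conj s₁ d = c⁻¹ * (s * w) * c * s⁻¹ * w⁻¹ := by
        rw [e3]
        simp only [map_mul, map_inv, e1, e2, mul_inv_rev, inv_inv]
        group
    _ = c⁻¹ * w * s * c * s⁻¹ * w⁻¹ := by rw [← hws.eq]; group
    _ = w * (c⁻¹ * (s * c * s⁻¹ * c⁻¹) * c) * w⁻¹ := by rw [← hwc.inv_right.eq]; group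
    _ = w * d * w⁻¹ := by rw [← e3, mul_assoc c⁻¹, ← hcd.eq, inv_mul_cancel_left]
    _ = d := by
        have : Commute w d := by
          rw [e3]
          exact ((hws.mul_right hwc).mul_right hws.inv_right).mul_right hwc.inv_right
        rw [this.eq, mul_inv_cancel_right]

theorem gammaSubgroup_three_le_of_notMem [Finite G] [Group.IsNilpotent G]
    (hab : (commutator G).index = 9) (hcard : 81 ≤ Nat.card G)
    (h81 : (gammaSubgroup G 4).index = 3 ^ 4) {z : G} (hz : z ∈ gammaSubgroup G 3)
    (hz4 : z ∉ gammaSubgroup G 4) : gammaSubgroup G 3 ≤ zpowers z ⊔ gammaSubgroup G 4 := by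
  have h3 : (gammaSubgroup G 4).relIndex (gammaSubgroup G 3) = 3 := by
    have hmul := relIndex_mul_index (gammaSubgroup_antitone (G := G) (by norm_num : 3 ≤ 4))
    rw [index_gammaSubgroup_three hab hcard, h81] at hmul
    omega
  have hle : zpowers z ⊔ gammaSubgroup G 4 ≤ gammaSubgroup G 3 :=
    sup_le (zpowers_le.mpr hz) (gammaSubgroup_antitone (by norm_num))
  have hmul := relIndex_mul_relIndex (gammaSubgroup G 4) _ _ le_sup_right hle
  rw [h3] at hmul
  rcases (Nat.dvd_prime Nat.prime_three).mp (Dvd.intro _ hmul) with h1 | h1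
  · exact absurd (relIndex_eq_one.mp h1 (mem_sup_left (mem_zpowers z))) hz4
  · rw [h1] at hmul
    exact relIndex_eq_one.mp (by omega)

/-- Commutation with `⁅y, x⁆` is a homomorphism from `G` to γ_3/γ_4, of order 3. Its kernel contains
`y`, or else `y^(-i) x`, where `i` expresses the value at `x` as a power of the value at `y`. -/
theorem exists_closure_pair_centralizing [Finite G] [Group.IsNilpotent G]
    (hab : (commutator G).index = 9) (hcard : 81 ≤ Nat.card G)
    (h81 : (gammaSubgroup G 4).index = 3 ^ 4) :
    ∃ s₁ s : G, closure {s₁, s} = ⊤ ∧ ∀ z ∈ gammaSubgroup G 2, ⁅s₁, z⁆ ∈ gammaSubgroup G 4 := by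
  obtain ⟨x, y, hxy⟩ := exists_closure_pair_eq_top hab hcard
  have hc : ⁅y, x⁆ ∈ gammaSubgroup G 2 :=
    commutatorElement_mem_gammaSubgroup_succ (n := 1) le_rfl y (mem_top _)
  have hp : ⁅x, ⁅y, x⁆⁆ ∈ gammaSubgroup G 3 :=
    commutatorElement_mem_gammaSubgroup_succ (by norm_num) x hc
  have hq : ⁅y, ⁅y, x⁆⁆ ∈ gammaSubgroup G 3 :=
    commutatorElement_mem_gammaSubgroup_succ (by norm_num) y hc
  suffices ∃ s₁ s : G, closure {s₁, s} = ⊤ ∧ ⁅s₁, ⁅y, x⁆⁆ ∈ gammaSubgroup G 4 by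
    obtain ⟨s₁, s, hs, h⟩ := this
    exact ⟨s₁, s, hs, fun z hz => commutatorElement_mem_of_gammaSubgroup_le (by norm_num)
      (gammaSubgroup_two_le_zpowers_sup hxy) le_rfl h hz⟩
  by_cases hq4 : ⁅y, ⁅y, x⁆⁆ ∈ gammaSubgroup G 4
  · exact ⟨y, x, by rwa [Set.pair_comm], hq4⟩
  obtain ⟨i, hi⟩ := mem_zpowers_sup_iff.mp
    (gammaSubgroup_three_le_of_notMem hab hcard h81 hq hq4 hp)
  refine ⟨(y ^ i)⁻¹ * x, y, ?_, ?_⟩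
  · have hy : y ∈ closure {(y ^ i)⁻¹ * x, y} := subset_closure (by simp)
    have hx : y ^ i * ((y ^ i)⁻¹ * x) ∈ closure {(y ^ i)⁻¹ * x, y} :=
      mul_mem (zpow_mem hy i) (subset_closure (by simp))
    rw [mul_inv_cancel_left] at hx
    rw [eq_top_iff, ← hxy, closure_le, Set.insert_subset_iff, Set.singleton_subset_iff]
    exact ⟨hx, hy⟩
  · have hcen : ∀ a : G, Commute ((⁅y, ⁅y, x⁆⁆ : G) : G ⧸ gammaSubgroup G 4) a := fun a =>
      (commute_mk_iff.mpr (commutatorElement_mem_gammaSubgroup_succ (by norm_num) a hq)).symm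
    -- Conjugation by `⁅y, x⁆⁻¹` multiplies `x` and `y` by central elements, the first being the
    -- `i`-th power of the second; hence it fixes `y^(-i) x`.
    have hconj : ∀ a : G, Commute ((⁅a, ⁅y, x⁆⁆ : G) : G ⧸ gammaSubgroup G 4) (⁅y, x⁆ : G) →
        MulAut.conj ((⁅y, x⁆ : G) : G ⧸ gammaSubgroup G 4)⁻¹ a = (⁅a, ⁅y, x⁆⁆ : G) * a := by
      intro a ha
      have e := conj_mk_eq (N := gammaSubgroup G 4) a ⁅y, x⁆
      rw [MulAut.conj_apply] at e ⊢
      rw [inv_inv, mul_assoc, mul_inv_eq_iff_eq_mul.mp e, ha.eq]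
      group
    have ex := hconj x (by rw [← hi]; exact (hcen _).zpow_left i)
    have ey := hconj y (hcen _)
    rw [← commute_mk_iff]
    have hfix : MulAut.conj ((⁅y, x⁆ : G) : G ⧸ gammaSubgroup G 4)⁻¹ ((y ^ i)⁻¹ * x : G) =
        ((y ^ i)⁻¹ * x : G) := by
      rw [QuotientGroup.mk_mul, QuotientGroup.mk_inv, QuotientGroup.mk_zpow, map_mul, map_inv,
        map_zpow, ex, ey, (hcen y).mul_zpow, ← hi, mul_inv_rev, mul_assoc,
        inv_mul_cancel_left]
    rw [MulAut.conj_apply, inv_inv, mul_assoc, inv_mul_eq_iff_eq_mul] at hfix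
    exact hfix

theorem isOfMaximalClass_of_index_gammaSubgroup_four [Finite G] [Group.IsNilpotent G]
    (hab : (commutator G).index = 9) (hcard : 81 ≤ Nat.card G)
    (h81 : (gammaSubgroup G 4).index = 3 ^ 4) : IsOfMaximalClass 3 G := by
  have hcube := pow_three_mem_gammaSubgroup_two hab hcard
  apply isOfMaximalClass_of_relIndex_dvd hab hcard
  obtain ⟨s₁, s, hgen, h2⟩ := exists_closure_pair_centralizing hab hcard h81
  have h3 : ∀ z ∈ gammaSubgroup G 3, ⁅s₁, z⁆ ∈ gammaSubgroup G 5 := fun z hz =>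
    commutatorElement_mem_gammaSubgroup_five hgen h2 hz
  by_cases hs : s ^ 3 ∈ gammaSubgroup G 4
  · exact fun n hn => relIndex_gammaSubgroup_dvd_three hgen hcube hs h2 h3 hn
  have hs3 := pow_three_mem_gammaSubgroup_three hab hcard s
  -- Here `s ^ 3` generates γ_3 modulo γ_4; it commutes with `s`, and with `s₁` modulo γ_5.
  have h45 : gammaSubgroup G 4 ≤ gammaSubgroup G 5 :=
    gammaSubgroup_succ_le_of_zpowers hgen (by norm_num)
      (gammaSubgroup_three_le_of_notMem hab hcard h81 hs3 hs) le_rfl (h3 _ hs3)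
      (by rw [(Commute.self_pow s 3).commutator_eq]; exact one_mem _)
  have hbot := gammaSubgroup_eq_bot_of_le_succ (by norm_num) h45
  intro n hn
  obtain rfl | rfl | hn : n = 2 ∨ n = 3 ∨ 4 ≤ n := by omega
  · rw [relIndex_gammaSubgroup_three_two hab hcard]
  · exact relIndex_dvd_of_le_zpowers_sup (pow_mem_gammaSubgroup_succ hcube (by norm_num) hs3)
      (gammaSubgroup_three_le_of_notMem hab hcard h81 hs3 hs)
  · have : gammaSubgroup G n = ⊥ := le_bot_iff.mp (hbot ▸ gammaSubgroup_antitone hn)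
    rw [this, relIndex_bot_right]
    exact one_dvd 3

end MaximalClass

theorem proposition5 {G : Type*} [Group G] [Finite G] (hG : IsPGroup 3 G)
    (hab : (commutator G).index = 9) (hcard : 81 ≤ Nat.card G) :
    (powerSubgroup G 3 = gammaSubgroup G 3 ∧ (gammaSubgroup G 3).index = 27) ∧
    (∀ H : Subgroup G, IsCoatom H → Group.rank H ≤ 3) ∧
    ((∃ H : Subgroup G, IsCoatom H ∧ IsMetacyclic H) ∨
      (∃ H : Subgroup G, IsCoatom H ∧ (commutator H).index ≤ 27)) ∧
    ((gammaSubgroup G 4).index = 3 ^ 4 → IsOfMaximalClass 3 G) := by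
  have : Fact (Nat.Prime 3) := ⟨Nat.prime_three⟩
  have := hG.isNilpotent
  exact ⟨⟨powerSubgroup_three_eq_gammaSubgroup_three hab hcard,
      index_gammaSubgroup_three hab hcard⟩,
    fun H hH => rank_le_three_of_isCoatom hab hcard hH,
    Or.inr (exists_isCoatom_index_commutator_le hab hcard),
    isOfMaximalClass_of_index_gammaSubgroup_four hab hcard⟩
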